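/- **Setting.** Let $\mathcal M$ be a layered Low-Rank MDP with horizon $H$, measurable state space $\mathcal X=\mathcal X_1\sqcup\dots\sqcup\mathcal X_H$, finite action space $\mathcal A$ with $|\mathcal A|=A\ge 1$, and initial distribution $\rho$ on $\mathcal X_1$. For $h<H$ the transition kernel $T_h(\cdot\mid x,a)$, $x\in\mathcal X_h$, is a probability measure carried by $\mathcal X_{h+1}$ with the (everywhere non-negative) density $y\mapsto \mu^\star_{h+1}(y)^\top\phi^\star_h(x,a)$ with respect to a $\sigma$-finite measure $\nu$ on $\mathcal X$, where $\mu^\star_h:\mathcal X\to\mathbb R^d$, $\phi^\star_h:\mathcal X\times\mathcal A\to\mathbb R^d$. Assume that $\|\phi_h^\star(x,a)\|\le 1$ for $x\in\mathcal X_h$, and that $\mu^\star_h$ is $\nu$-integrable on $\mathcal X_h$ with $\big\|\int_{\mathcal X_h}\mu_h^\star\, g\,d\nu\big\|\le\sqrt d$ for all measurable $g:\mathcal X_h\to[0,1]$, for every $h\in[H]$. Let $\Pi_{\mathtt M}$ be the set of randomized Markov policies $\pi:\mathcal X\to\Delta(\mathcal A)$, $\mathbb E^\pi$ the expectation over the trajectory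 $(x_1,a_1),\dots,(x_H,a_H)$ when $\pi$ is played, and $d^\pi(x)$, $x\in\mathcal X_h$, the density with respect to $\nu$ of the law of $x_h$ under $\pi$ (for $h\ge2$ the version $d^\pi(x)=\mu_h^\star(x)^\top\mathbb E^\pi[\phi^\star_{h-1}(x_{h-1},a_{h-1})]$). A distribution $P\in\Delta(\Pi_{\mathtt M})$ is an $(\alpha,\varepsilon)$-randomized policy cover for layer $h$ if $\mathbb E_{\pi\sim P}[d^\pi(x)]\ge\alpha\sup_{\pi'\in\Pi_{\mathtt M}}d^{\pi'}(x)$ for all $x\in\mathcal X_h$ with $\sup_{\pi'\in\Pi_{\mathtt M}}d^{\pi'}(x)\ge\varepsilon\|\mu_h^\star(x)\|$. Let $\Phi$ be a finite class of measurable maps $\phi:\mathcal X\times\mathcal A\to\mathbb R^d$ with $\|\phi(x,a)\|\le1$ for all $(x,a)$ and $\phi^\star_h\in\Phi$ for all $h\in[H]$. **Algorithm.** Given rewards $r_{1:H}$, function classes $\mathcal G_{1:H}$, distributions $P^{(1)},\dots,P^{(H)}\in\Delta(\Pi_{\mathtt M})$ and $n\ge1$, $\mathtt{PSDP}(H,r_{1:H},\mathcal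 G_{1:H},P^{(1:H)},n)$ does the following for $t=H,\dots,1$. It draws $n$ independent samples $(x_t,a_t,\sum_{\ell=t}^Hr_\ell(x_\ell,a_\ell))$, each from an episode in which a fresh $\pi\sim P^{(t)}$ is played on layers $1,\dots,t-1$, a uniformly random action on layer $t$, and the already learned policy $\hat\pi^{(t+1)}$ on layers $t+1,\dots,H$. It takes a least-squares solution $\hat g^{(t)}\in\arg\min_{g\in\mathcal G_t}\sum_{(x,a,R)}(g(x,a)-R)^2$ over these samples, and lets $\hat\pi^{(t)}(x)\in\arg\max_{a}\hat g^{(t)}(x,a)$ for $x\in\mathcal X_t$ and $\hat\pi^{(t)}=\hat\pi^{(t+1)}$ on the later layers. It returns $\hat\pi=\hat\pi^{(1)}$. (Ties in the $\arg\min$ and the $\arg\max$ are broken by any measurable rule.) **Statement.** There is an absolute constant $c>0$ such that the following holds for all $\mathcal M$ and $\Phi$ as above, all $\alpha,\varepsilon,\delta\in(0,1)$ and all $n\ge1$. Let $r_h(x,a)=\theta_h^\top\phi_h^\star(x,a)$ with $\theta_h\in\mathbb R^d$, $\|\theta_h\|\le1$, for $h\in[H]$; let $$\mathcal G_h=\mathcal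 G=\{(x,a)\mapsto\phi(x,a)^\top w\;:\;\phi\in\Phi,\ w\in\mathbb R^d,\ \|w\|\le 2H\sqrt d\}\qquad(h\in[H]);$$ and let $P^{(h)}$ be an $(\alpha,\varepsilon)$-randomized policy cover for layer $h$, for each $h\in[H]$. Then, with probability at least $1-\delta$, the output $\hat\pi$ of $\mathtt{PSDP}(H,r_{1:H},\mathcal G_{1:H},P^{(1:H)},n)$ satisfies $$\sup_{\pi\in\Pi_{\mathtt M}}\mathbb E^{\pi}\Big[\sum_{h=1}^Hr_h(x_h,a_h)\Big]\le\mathbb E^{\hat\pi}\Big[\sum_{h=1}^Hr_h(x_h,a_h)\Big]+cH^2\sqrt{\frac{dA\,\big(d\log(2n\sqrt d\,H)+\ln(n|\Phi|/\delta)\big)}{\alpha n}}+2H^2\varepsilon d^{3/2}.$$ -/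

import Mathlib

open MeasureTheory ProbabilityTheory

namespace LowRank

noncomputable section

/-- A randomized Markovian policy `π : 𝒳 → Δ(𝒜)`, as a Markov kernel. -/
def Policy (X A : Type*) [MeasurableSpace X] [MeasurableSpace A] :=
  {κ : Kernel X A // IsMarkovKernel κ}

/-- A layered Low-Rank MDP with horizon `H` and feature dimension `d`.
Layers (time steps) are numbered `0, …, H - 1`, and `layer x = h` says that `x ∈ 𝒳_h`; so the
sets `𝒳_h` are disjoint, measurable and cover the state space.  Since the layers are disjoint, a
single kernel `T` holds all the transition kernels: `T (x, a)` is `T_h(· ∣ x, a)` when `x ∈ 𝒳_h`.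
The value of `T` on the last layer never matters. -/
structure LowRankMDP (X A : Type*) [MeasurableSpace X] [MeasurableSpace A] (d H : ℕ) where
  /-- law of the initial state -/
  ρ : Measure X
  ρ_prob : IsProbabilityMeasure ρ
  /-- transition kernel -/
  T : Kernel (X × A) X
  T_markov : IsMarkovKernel T
  /-- base measure -/
  ν : Measure X
  ν_sigmaFinite : SigmaFinite ν
  layer : X → Fin H
  layer_measurable : Measurable layer
  /-- the true features `φ⋆_h` -/
  φ : Fin H → X → A → EuclideanSpace ℝ (Fin d)
  φ_measurable : ∀ h a, Measurable fun x => φ h x a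
  /-- the maps `μ⋆_h` -/
  μ : Fin H → X → EuclideanSpace ℝ (Fin d)
  μ_measurable : ∀ h, Measurable (μ h)
  ρ_layer : ∀ᵐ x ∂ρ, (layer x : ℕ) = 0
  T_layer : ∀ x a, (layer x : ℕ) + 1 < H → ∀ᵐ y ∂(T (x, a)), (layer y : ℕ) = layer x + 1
  /-- `y ↦ ⟨μ⋆_{h+1}(y), φ⋆_h(x, a)⟩` is nonnegative ... -/
  density_nonneg : ∀ h h' : Fin H, (h' : ℕ) = h + 1 → ∀ x, layer x = h → ∀ a y,
    0 ≤ inner ℝ (μ h' y) (φ h x a)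
  /-- ... and it is the density of `T_h(· ∣ x, a)` with respect to `ν`. -/
  T_eq : ∀ h h' : Fin H, (h' : ℕ) = h + 1 → ∀ x, layer x = h → ∀ a,
    T (x, a) = ν.withDensity fun y => ENNReal.ofReal (inner ℝ (μ h' y) (φ h x a))
  φ_norm : ∀ h x a, layer x = h → ‖φ h x a‖ ≤ 1
  μ_integrable : ∀ h, IntegrableOn (μ h) {x | layer x = h} ν
  μ_normalized : ∀ h, ∀ g : X → ℝ, Measurable g → (∀ x, 0 ≤ g x ∧ g x ≤ 1) →
    ‖∫ x in {x | layer x = h}, g x • μ h x ∂ν‖ ≤ √(d : ℝ)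

attribute [instance] LowRankMDP.ρ_prob LowRankMDP.T_markov LowRankMDP.ν_sigmaFinite

variable {X A : Type*} [MeasurableSpace X] [MeasurableSpace A] {d H : ℕ}

namespace LowRankMDP

/-! ### Trajectories -/

/-- Law of the `k` state-action pairs met from now on, when the current state is `x` and the
policy `π` is played: `a ∼ π(x)`, `x' ∼ T(x, a)`, and so on from `x'`. -/
def rollout (M : LowRankMDP X A d H) (π : Policy X A) : (k : ℕ) → Kernel X (Fin k → X × A)
  | 0 => Kernel.const X (Measure.dirac Fin.elim0)
  | k + 1 => ((Kernel.id ×ₖ (rollout M π k ∘ₖ M.T)) ∘ₖ (Kernel.id ×ₖ π.1)).map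
      fun p => Fin.cons (α := fun _ => X × A) p.1 p.2

/-- `ℙ^π`: the law of `(x_0, a_0), …, (x_{H-1}, a_{H-1})`. -/
def trajLaw (M : LowRankMDP X A d H) (π : Policy X A) : Measure (Fin H → X × A) :=
  M.ρ.bind (M.rollout π H)

/-- `ℙ_h^π`: the law of `x_h`. -/
def stateLaw (M : LowRankMDP X A d H) (π : Policy X A) (h : Fin H) : Measure X :=
  (M.trajLaw π).map fun τ => (τ h).1

/-- `𝔼^π[∑_h r_h(x_h, a_h)]`. -/
def value (M : LowRankMDP X A d H) (r : Fin H → X → A → ℝ) (π : Policy X A) : ℝ :=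
  ∫ τ, ∑ h, r h (τ h).1 (τ h).2 ∂(M.trajLaw π)

/-- The occupancy `d^π(x)` for `x` in layer `h`: the density of `ℙ_h^π` with respect to `ν`.
On the layers after the first one it is the everywhere defined version
`⟨μ⋆_h(x), 𝔼^π[φ⋆_{h-1}(x_{h-1}, a_{h-1})]⟩` of the density; on the first layer `ℙ_0^π = ρ`
whatever `π` is. -/
def occupancy (M : LowRankMDP X A d H) (π : Policy X A) (h : Fin H) (x : X) : ℝ :=
  if (h : ℕ) = 0 then (M.ρ.rnDeriv M.ν x).toReal
  else
    let g : Fin H := ⟨(h : ℕ) - 1, lt_of_le_of_lt (Nat.sub_le _ _) h.2⟩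
    inner ℝ (M.μ h x) (∫ τ, M.φ g (τ g).1 (τ g).2 ∂(M.trajLaw π))

/-! The everywhere defined occupancy is indeed a density of the law of the state. -/

lemma measurable_cons {k : ℕ} : Measurable fun p : (X × A) × (Fin k → X × A) =>
    Fin.cons (α := fun _ => X × A) p.1 p.2 := by
  refine measurable_pi_iff.2 fun i => ?_
  refine Fin.cases ?_ (fun j => ?_) i
  · simpa using measurable_fst
  · simp only [Fin.cons_succ]
    exact (measurable_pi_apply j).comp measurable_snd

instance rollout_markov (M : LowRankMDP X A d H) (π : Policy X A) (k : ℕ) :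
    IsMarkovKernel (M.rollout π k) := by
  have := π.2
  induction k with
  | zero => rw [rollout]; infer_instance
  | succ k ih => rw [rollout]; exact Kernel.IsMarkovKernel.map _ measurable_cons

instance trajLaw_prob (M : LowRankMDP X A d H) (π : Policy X A) :
    IsProbabilityMeasure (M.trajLaw π) := by
  unfold trajLaw; infer_instance

lemma lintegral_rollout_succ (M : LowRankMDP X A d H) (π : Policy X A) (k : ℕ) (x : X)
    {f : (Fin (k + 1) → X × A) → ENNReal} (hf : Measurable f) :
    ∫⁻ τ, f τ ∂(M.rollout π (k + 1) x) =
      ∫⁻ a, ∫⁻ y, ∫⁻ τ, f (Fin.cons (x, a) τ) ∂(M.rollout π k y) ∂(M.T (x, a)) ∂(π.1 x) := by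
  have := π.2
  have hc : Measurable fun p : (X × A) × (Fin k → X × A) =>
      f (Fin.cons (α := fun _ => X × A) p.1 p.2) := hf.comp measurable_cons
  rw [rollout, Kernel.map_apply _ measurable_cons, lintegral_map hf measurable_cons,
    Kernel.lintegral_comp _ _ _ hc, Kernel.lintegral_id_prod]
  · refine lintegral_congr fun a => ?_
    rw [Kernel.lintegral_id_prod hc, Kernel.lintegral_comp]
    exact hc.comp measurable_prodMk_left
  · exact hc.lintegral_kernel

lemma lintegral_rollout_zero (M : LowRankMDP X A d H) (π : Policy X A) (k : ℕ) (x : X)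
    {f : X → ENNReal} (hf : Measurable f) :
    ∫⁻ τ, f (τ 0).1 ∂(M.rollout π (k + 1) x) = f x := by
  have := π.2
  rw [lintegral_rollout_succ]
  · simp
  · exact hf.comp (measurable_fst.comp (measurable_pi_apply 0))

lemma lintegral_rollout_step (M : LowRankMDP X A d H) (π : Policy X A) {f : X → ENNReal}
    (hf : Measurable f) (k : ℕ) : ∀ (x : X) (h h' : Fin k), (h' : ℕ) = h + 1 →
    ∫⁻ τ, f (τ h').1 ∂(M.rollout π k x) =
      ∫⁻ τ, ∫⁻ y, f y ∂(M.T (τ h)) ∂(M.rollout π k x) := by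
  have := π.2
  induction k with
  | zero => intro x h; exact h.elim0
  | succ k ih =>
    intro x h h' hh
    have m1 : ∀ {k} (j : Fin k), Measurable fun τ : Fin k → X × A => f (τ j).1 := fun j =>
      hf.comp (measurable_fst.comp (measurable_pi_apply j))
    have m2 : ∀ {k} (j : Fin k), Measurable fun τ : Fin k → X × A => ∫⁻ y, f y ∂(M.T (τ j)) :=
      fun j => (hf.lintegral_kernel (κ := M.T)).comp (measurable_pi_apply j)
    rw [lintegral_rollout_succ _ _ _ _ (m1 h'), lintegral_rollout_succ _ _ _ _ (m2 h)]
    refine lintegral_congr fun a => ?_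
    obtain ⟨j', rfl⟩ : ∃ j', h' = Fin.succ j' :=
      ⟨h'.pred (by rintro rfl; simp at hh), by simp⟩
    simp only [Fin.cons_succ]
    rcases Fin.eq_zero_or_eq_succ h with rfl | ⟨j, rfl⟩
    · obtain ⟨k, rfl⟩ : ∃ k', k = k' + 1 := ⟨k - 1, by have := j'.2; omega⟩
      have : j' = 0 := by ext; simpa using hh
      subst this
      simp [lintegral_rollout_zero _ _ _ _ hf]
    · refine lintegral_congr fun y => ?_
      simp only [Fin.cons_succ]
      exact ih y j j' (by simpa using hh)

lemma lintegral_trajLaw_step (M : LowRankMDP X A d H) (π : Policy X A) {f : X → ENNReal}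
    (hf : Measurable f) (h h' : Fin H) (hh : (h' : ℕ) = h + 1) :
    ∫⁻ τ, f (τ h').1 ∂(M.trajLaw π) = ∫⁻ τ, ∫⁻ y, f y ∂(M.T (τ h)) ∂(M.trajLaw π) := by
  unfold trajLaw
  rw [Measure.lintegral_bind (Kernel.aemeasurable _), Measure.lintegral_bind (Kernel.aemeasurable _)]
  · exact lintegral_congr fun x => lintegral_rollout_step M π hf H x h h' hh
  · exact ((hf.lintegral_kernel (κ := M.T)).comp (measurable_pi_apply h)).aemeasurable
  · exact (hf.comp (measurable_fst.comp (measurable_pi_apply h'))).aemeasurable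

lemma stateLaw_zero (M : LowRankMDP X A d H) (π : Policy X A) (h : Fin H) (hh : (h : ℕ) = 0) :
    M.stateLaw π h = M.ρ := by
  obtain ⟨H, rfl⟩ : ∃ k', H = k' + 1 := ⟨H - 1, by have := h.2; omega⟩
  have : h = 0 := by ext; simpa using hh
  subst this
  ext s hs
  have m : Measurable fun τ : Fin (H + 1) → X × A => (τ 0).1 :=
    measurable_fst.comp (measurable_pi_apply 0)
  rw [stateLaw, ← lintegral_indicator_one hs, lintegral_map (measurable_one.indicator hs) m,
    trajLaw, Measure.lintegral_bind (Kernel.aemeasurable _)]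
  · simp_rw [lintegral_rollout_zero M π H _ (f := s.indicator 1) (measurable_one.indicator hs)]
    rw [lintegral_indicator_one hs]
  · exact ((measurable_one.indicator hs).comp m).aemeasurable

lemma ae_layer (M : LowRankMDP X A d H) (π : Policy X A) : ∀ (k : ℕ) (hk : k < H),
    ∀ᵐ τ ∂(M.trajLaw π), M.layer (τ ⟨k, hk⟩).1 = ⟨k, hk⟩ := by
  intro k
  have m : ∀ h : Fin H, Measurable fun τ : Fin H → X × A => (τ h).1 := fun h =>
    measurable_fst.comp (measurable_pi_apply h)
  induction k with
  | zero =>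
    intro hk
    have := M.ρ_layer
    rw [← stateLaw_zero M π ⟨0, hk⟩ rfl, stateLaw] at this
    filter_upwards [ae_of_ae_map (m _).aemeasurable this] with τ hτ
    ext; simpa using hτ
  | succ k ih =>
    intro hk
    have hs : MeasurableSet {x | M.layer x ≠ ⟨k + 1, hk⟩} :=
      M.layer_measurable (MeasurableSet.of_discrete (s := {j : Fin H | j ≠ ⟨k + 1, hk⟩}))
    have key := lintegral_trajLaw_step M π (f := {x | M.layer x ≠ ⟨k + 1, hk⟩}.indicator 1)
      (measurable_one.indicator hs) ⟨k, by omega⟩ ⟨k + 1, hk⟩ rfl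
    have z : ∫⁻ τ, ∫⁻ y, {x | M.layer x ≠ ⟨k + 1, hk⟩}.indicator 1 y ∂(M.T (τ ⟨k, by omega⟩))
        ∂(M.trajLaw π) = 0 := by
      rw [← lintegral_zero (μ := M.trajLaw π)]
      refine lintegral_congr_ae ?_
      filter_upwards [ih (by omega)] with τ hτ
      rw [lintegral_indicator_one hs]
      have := M.T_layer (τ ⟨k, by omega⟩).1 (τ ⟨k, by omega⟩).2 (by rw [hτ]; exact hk)
      rw [hτ] at this
      refine measure_mono_null ?_ (ae_iff.1 this)
      intro y hy h
      exact hy (by ext; simpa using h)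
    rw [z] at key
    filter_upwards [(lintegral_eq_zero_iff ((measurable_one.indicator hs).comp (m _))).1 key] with τ hτ
    by_contra hne
    simp [hne] at hτ

/-- The occupancy is the density of the law of the state, on every layer after the first one. -/
theorem stateLaw_eq_withDensity [Fintype A] [MeasurableSingletonClass A]
    (M : LowRankMDP X A d H) (π : Policy X A) (h : Fin H) (hh : (h : ℕ) ≠ 0) :
    M.stateLaw π h = M.ν.withDensity fun x => ENNReal.ofReal (M.occupancy π h x) := by
  set g : Fin H := ⟨(h : ℕ) - 1, lt_of_le_of_lt (Nat.sub_le _ _) h.2⟩ with hg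
  have hgh : (h : ℕ) = g + 1 := by simp [hg]; omega
  have mφ : Measurable fun τ : Fin H → X × A => M.φ g (τ g).1 (τ g).2 :=
    (measurable_from_prod_countable_left (f := fun p : X × A => M.φ g p.1 p.2)
      (M.φ_measurable g)).comp (measurable_pi_apply g)
  have aeg := ae_layer M π g g.2
  have iφ : Integrable (fun τ : Fin H → X × A => M.φ g (τ g).1 (τ g).2) (M.trajLaw π) := by
    refine Integrable.of_bound mφ.aestronglyMeasurable 1 ?_
    filter_upwards [aeg] with τ hτ
    exact M.φ_norm g _ _ hτ
  have m : Measurable fun τ : Fin H → X × A => (τ h).1 :=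
    measurable_fst.comp (measurable_pi_apply h)
  ext s hs
  rw [stateLaw, ← lintegral_indicator_one hs, lintegral_map (measurable_one.indicator hs) m,
    lintegral_trajLaw_step M π (measurable_one.indicator hs) g h hgh,
    withDensity_apply _ hs]
  have e1 : ∫⁻ τ, ∫⁻ y, s.indicator 1 y ∂(M.T (τ g)) ∂(M.trajLaw π) =
      ∫⁻ τ, ∫⁻ y in s, ENNReal.ofReal (inner ℝ (M.μ h y) (M.φ g (τ g).1 (τ g).2)) ∂M.ν
        ∂(M.trajLaw π) := by
    refine lintegral_congr_ae ?_
    filter_upwards [aeg] with τ hτ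
    rw [lintegral_indicator_one hs, ← withDensity_apply _ hs, ← M.T_eq g h hgh _ hτ]
  rw [e1, lintegral_lintegral_swap]
  · refine lintegral_congr fun y => ?_
    rw [occupancy, if_neg hh, ← ofReal_integral_eq_lintegral_ofReal]
    · congr 1
      exact integral_inner iφ _
    · exact iφ.const_inner _
    · filter_upwards [aeg] with τ hτ
      exact M.density_nonneg g h hgh _ hτ _ _
  · refine Measurable.aemeasurable (ENNReal.measurable_ofReal.comp ?_)
    exact ((M.μ_measurable h).comp measurable_snd).inner (mφ.comp measurable_fst)

end LowRankMDP

/-! ### Distributions over policies and policy covers -/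

/-- A distribution `P ∈ Δ(Π_M)`: a policy chosen through a random index. The policy with index `i`
is `x ↦ kernel (i, x)`. -/
structure PolicyDist.{u, v, w} (X : Type u) (A : Type v) [MeasurableSpace X]
    [MeasurableSpace A] where
  Idx : Type w
  idxSpace : MeasurableSpace Idx
  law : Measure Idx
  law_prob : IsProbabilityMeasure law
  kernel : Kernel (Idx × X) A
  kernel_markov : IsMarkovKernel kernel

attribute [instance] PolicyDist.idxSpace PolicyDist.law_prob PolicyDist.kernel_markov

/-- The policy with index `i`. -/
def PolicyDist.policy (P : PolicyDist X A) (i : P.Idx) : Policy X A :=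
  ⟨P.kernel.comap (fun x => (i, x)) measurable_prodMk_left, inferInstance⟩

/-- `P` is an `(α, ε)`-randomized policy cover for layer `h`. -/
def IsRandomizedPolicyCover (M : LowRankMDP X A d H) (P : PolicyDist X A) (α ε : ℝ)
    (h : Fin H) : Prop :=
  ∀ x, M.layer x = h → ε * ‖M.μ h x‖ ≤ (⨆ π : Policy X A, M.occupancy π h x) →
    α * (⨆ π : Policy X A, M.occupancy π h x) ≤ ∫ i, M.occupancy (P.policy i) h x ∂P.law

/-! ### Rewards and function classes -/

/-- The rewards `r_h(x, a) = ⟨θ_h, φ⋆_h(x, a)⟩`. -/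
def linearReward (M : LowRankMDP X A d H) (θ : Fin H → EuclideanSpace ℝ (Fin d)) :
    Fin H → X → A → ℝ :=
  fun h x a => inner ℝ (θ h) (M.φ h x a)

/-- The class of the functions `(x, a) ↦ ⟨φ(x, a), w⟩` with `φ ∈ Φ` and `‖w‖ ≤ R`. -/
def linearClass (Φ : Finset (X → A → EuclideanSpace ℝ (Fin d))) (R : ℝ) : Set (X → A → ℝ) :=
  {g | ∃ φ ∈ Φ, ∃ w : EuclideanSpace ℝ (Fin d), ‖w‖ ≤ R ∧ g = fun x a => inner ℝ (φ x a) w}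

/-! ### PSDP -/

/-- `n` observations `(x, a, R)`. -/
abbrev Dataset (X A : Type*) (n : ℕ) := Fin n → X × A × ℝ

def squareLoss {n : ℕ} (D : Dataset X A n) (g : X → A → ℝ) : ℝ :=
  ∑ i, (g (D i).1 (D i).2.1 - (D i).2.2) ^ 2

/-- A way of resolving, measurably, the choices left open by the `argmin` and the `argmax` of PSDP
with function classes `G`: `fit t D` is a least-squares solution in `G t` for the dataset `D`,
and `act t D x` is an action that maximizes `fit t D x`. -/
structure Selection (G : Fin H → Set (X → A → ℝ)) (n : ℕ) where
  fit : Fin H → Dataset X A n → X → A → ℝ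
  fit_mem : ∀ t D, fit t D ∈ G t
  fit_min : ∀ t D, ∀ g ∈ G t, squareLoss D (fit t D) ≤ squareLoss D g
  act : Fin H → Dataset X A n → X → A
  act_max : ∀ t D x a, fit t D x a ≤ fit t D x (act t D x)
  fit_measurable : ∀ t a, Measurable fun p : Dataset X A n × X => fit t p.1 p.2 a
  act_measurable : ∀ t, Measurable fun p : Dataset X A n × X => act t p.1 p.2

section Policies

variable [Nonempty A]

/-- `π_unif`. -/
def unifPolicy [Fintype A] [MeasurableSingletonClass A] : Policy X A :=
  ⟨Kernel.const X (uniformOn Set.univ),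
    haveI : IsProbabilityMeasure (uniformOn (Set.univ : Set A)) :=
      isProbabilityMeasure_uniformOn Set.finite_univ Set.univ_nonempty
    inferInstance⟩

open Classical in
/-- `π ∘_t π'`: play `π` on the layers before `t`, and `π'` from layer `t` on. -/
def concat (M : LowRankMDP X A d H) (π : Policy X A) (t : ℕ) (π' : Policy X A) : Policy X A :=
  ⟨Kernel.piecewise (s := {x | (M.layer x : ℕ) < t})
      (M.layer_measurable (MeasurableSet.of_discrete (s := {j : Fin H | (j : ℕ) < t}))) π.1 π'.1,
    haveI := π.2
    haveI := π'.2
    inferInstance⟩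

/-- The action that the greedy policy learned from the datasets `D` of the last `k` layers
`H - k, …, H - 1` (in this order) takes at a state `x` of layer `j`. On the earlier layers this
policy is not defined by the algorithm (and never played); an arbitrary action stands in. -/
def learnedAct {G : Fin H → Set (X → A → ℝ)} {n : ℕ} (S : Selection G n) {k : ℕ}
    (D : Fin k → Dataset X A n) (j : Fin H) (x : X) : A :=
  if hj : H - k ≤ (j : ℕ) then S.act j (D ⟨(j : ℕ) - (H - k), by omega⟩) x
  else Classical.arbitrary A

lemma learnedAct_measurable {G : Fin H → Set (X → A → ℝ)} {n : ℕ} (S : Selection G n) {k : ℕ}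
    (D : Fin k → Dataset X A n) (j : Fin H) : Measurable (learnedAct S D j) := by
  unfold learnedAct
  split_ifs with hj
  · exact (S.act_measurable j).comp measurable_prodMk_left
  · exact measurable_const

/-- The partial policy `π̂^{(t)}`, `t = H - k`, learned from the datasets of the last `k` layers. -/
def learnedPolicy (M : LowRankMDP X A d H) {G : Fin H → Set (X → A → ℝ)} {n : ℕ}
    (S : Selection G n) {k : ℕ} (D : Fin k → Dataset X A n) : Policy X A :=
  ⟨Kernel.deterministic (fun x => learnedAct S D (M.layer x) x)
      ((measurable_from_prod_countable_right (f := fun p : Fin H × X => learnedAct S D p.1 p.2)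
        (learnedAct_measurable S D)).comp (M.layer_measurable.prodMk measurable_id)),
    inferInstance⟩

variable [Fintype A] [MeasurableSingletonClass A]

/-- The law of one observation `(x_t, a_t, ∑_{ℓ ≥ t} r_ℓ(x_ℓ, a_ℓ))` under
`π ∘_t π_unif ∘_{t+1} π'`, with `π ∼ P`. -/
def sampleLaw (M : LowRankMDP X A d H) (r : Fin H → X → A → ℝ) (P : PolicyDist X A) (t : Fin H)
    (π' : Policy X A) : Measure (X × A × ℝ) :=
  P.law.bind fun i =>
    (M.trajLaw (concat M (P.policy i) t (concat M unifPolicy (t + 1) π'))).map fun τ =>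
      ((τ t).1, (τ t).2, ∑ l with t ≤ l, r l (τ l).1 (τ l).2)

/-- The joint law of the datasets that `PSDP(H, r, G, P, n)` has drawn after its first `k` rounds,
that is, those of the layers `H - k, …, H - 1`. In the next round `n` independent observations are
drawn at the layer `t = H - k - 1`, with the policy learned from the earlier datasets played after
layer `t`. -/
def psdpLaw (M : LowRankMDP X A d H) (r : Fin H → X → A → ℝ) {G : Fin H → Set (X → A → ℝ)}
    {n : ℕ} (S : Selection G n) (P : Fin H → PolicyDist X A) :
    (k : ℕ) → k ≤ H → Measure (Fin k → Dataset X A n)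
  | 0, _ => Measure.dirac Fin.elim0
  | k + 1, hk =>
    let t : Fin H := ⟨H - (k + 1), by omega⟩
    (psdpLaw M r S P k (by omega)).bind fun D =>
      (Measure.pi fun _ : Fin n => sampleLaw M r (P t) t (learnedPolicy M S D)).map fun D' =>
        Fin.cons (α := fun _ => Dataset X A n) D' D

end Policies

end

end LowRank

/-!
The action values of any policy are linear in `φ⋆`, so each regression of the algorithm is
realizable. The variance of an excess squared loss is controlled by its mean, and a finite net of
the linear class turns the resulting exponential bounds into a squared error of order `1 / n` for
every least-squares fit, on the states that the policies drawn from `P` visit. A policy cover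
transfers this error, at the price of `α⁻¹`, to the states that any other policy visits, except on a
set where every occupancy is at most `ε ‖μ⋆‖`; there the values are bounded trivially, and the
normalization of `μ⋆` gives `∫ ‖μ⋆‖ ≤ 2 d √d`. Hence at every layer no policy gains much over the
greedy action, and the performance difference lemma adds up the layers. As the policy learned on the
later layers is independent of the data of the current one, the failure probabilities simply add up.
-/

namespace LowRank

noncomputable section

/-! ### Concentration -/

section Concentration

variable {Ω : Type*} [MeasurableSpace Ω] (m : Measure Ω) [IsProbabilityMeasure m]

theorem mgf_sum_pi {ι : Type*} [Fintype ι] (l : Ω → ℝ) (t : ℝ) :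
    mgf (fun D : ι → Ω => ∑ i, l (D i)) (Measure.pi fun _ => m) t =
      mgf l m t ^ Fintype.card ι := by
  simp only [mgf, Finset.mul_sum, Real.exp_sum]
  exact integral_fintype_prod_eq_pow (fun z => Real.exp (t * l z))

variable {m} {l : Ω → ℝ} {b : ℝ}

theorem integrable_exp_mul_of_abs_le (hl : Measurable l) (hlb : ∀ᵐ z ∂m, |l z| ≤ b) (t : ℝ) :
    Integrable (fun z => Real.exp (t * l z)) m := by
  refine .of_bound (by fun_prop) (Real.exp (|t| * b)) ?_
  filter_upwards [hlb] with z hz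
  rw [Real.norm_eq_abs, Real.abs_exp, Real.exp_le_exp]
  exact (le_abs_self _).trans ((abs_mul _ _).trans_le (by gcongr))

theorem integrable_sq_of_abs_le (hl : Measurable l) (hlb : ∀ᵐ z ∂m, |l z| ≤ b) :
    Integrable (fun z => l z ^ 2) m := by
  refine .of_bound (by fun_prop) (b ^ 2) ?_
  filter_upwards [hlb] with z hz
  rw [Real.norm_eq_abs, abs_pow]
  gcongr

theorem mgf_neg_le_of_integral_sq_le (hl : Measurable l) (hlb : ∀ᵐ z ∂m, |l z| ≤ b)
    (hvar : ∫ z, l z ^ 2 ∂m ≤ b * ∫ z, l z ∂m) {t : ℝ} (ht : 0 ≤ t) (htb : t * b ≤ 1) :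
    mgf l m (-t) ≤ Real.exp (-((t - b * t ^ 2) * ∫ z, l z ∂m)) := by
  have hint : Integrable l m := .of_bound hl.aestronglyMeasurable b hlb
  have hint_sub : Integrable (fun z => 1 - t * l z) m :=
    (integrable_const _).sub (hint.const_mul t)
  have hint_sq := (integrable_sq_of_abs_le hl hlb).const_mul (t ^ 2)
  have hpointwise : ∀ᵐ z ∂m, Real.exp (-t * l z) ≤ 1 - t * l z + t ^ 2 * l z ^ 2 := by
    filter_upwards [hlb] with z hz
    have habs : |-t * l z| ≤ 1 := by
      rw [abs_mul, abs_neg, abs_of_nonneg ht]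
      exact (mul_le_mul_of_nonneg_left hz ht).trans htb
    linarith [(abs_le.1 (Real.abs_exp_sub_one_sub_id_le habs)).2]
  calc mgf l m (-t) ≤ ∫ z, (1 - t * l z + t ^ 2 * l z ^ 2) ∂m :=
        integral_mono_ae (integrable_exp_mul_of_abs_le hl hlb (-t)) (hint_sub.add hint_sq)
          hpointwise
    _ = 1 - t * ∫ z, l z ∂m + t ^ 2 * ∫ z, l z ^ 2 ∂m := by
        rw [integral_add hint_sub hint_sq, integral_sub (integrable_const _) (hint.const_mul t),
          integral_const_mul, integral_const_mul]
        simp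
    _ ≤ 1 - t * ∫ z, l z ∂m + t ^ 2 * (b * ∫ z, l z ∂m) := by gcongr
    _ = -((t - b * t ^ 2) * ∫ z, l z ∂m) + 1 := by ring
    _ ≤ _ := Real.add_one_le_exp _

theorem measure_sum_lt_le_of_integral_sq_le (hb : 0 < b) (hl : Measurable l)
    (hlb : ∀ᵐ z ∂m, |l z| ≤ b) (hvar : ∫ z, l z ^ 2 ∂m ≤ b * ∫ z, l z ∂m) (n : ℕ) (s : ℝ) :
    (Measure.pi fun _ : Fin n => m)
      {D | ∑ i, l (D i) < n * (∫ z, l z ∂m) / 2 - 2 * b * s} ≤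
      ENNReal.ofReal (Real.exp (-s)) := by
  set e := ∫ z, l z ∂m
  set t := 1 / (2 * b) with ht
  have ht0 : 0 ≤ t := by positivity
  have hexp : Integrable (fun D : Fin n → Ω => Real.exp (-t * ∑ i, l (D i)))
      (Measure.pi fun _ => m) := by
    simp only [Finset.mul_sum, Real.exp_sum]
    exact Integrable.fintype_prod (f := fun _ z => Real.exp (-t * l z)) fun _ =>
      integrable_exp_mul_of_abs_le hl hlb (-t)
  rw [← ofReal_measureReal]
  refine ENNReal.ofReal_le_ofReal ?_
  have hsub : {D : Fin n → Ω | ∑ i, l (D i) < n * e / 2 - 2 * b * s} ⊆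
      {D | ∑ i, l (D i) ≤ n * e / 2 - 2 * b * s} :=
    Set.ofPred_subset_ofPred.2 fun D hD => hD.le
  calc (Measure.pi fun _ : Fin n => m).real {D | ∑ i, l (D i) < n * e / 2 - 2 * b * s}
    _ ≤ (Measure.pi fun _ : Fin n => m).real {D | ∑ i, l (D i) ≤ n * e / 2 - 2 * b * s} :=
        measureReal_mono hsub
    _ ≤ Real.exp (-(-t) * (n * e / 2 - 2 * b * s)) *
          mgf (fun D : Fin n → Ω => ∑ i, l (D i)) (Measure.pi fun _ => m) (-t) :=
        measure_le_le_exp_mul_mgf _ (neg_nonpos.2 ht0) hexp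
    _ ≤ Real.exp (-(-t) * (n * e / 2 - 2 * b * s)) * Real.exp (-((t - b * t ^ 2) * e)) ^ n := by
        rw [mgf_sum_pi, Fintype.card_fin]
        gcongr
        · exact mgf_nonneg
        · refine mgf_neg_le_of_integral_sq_le hl hlb hvar ht0 ?_
          rw [ht, one_div_mul_eq_div, div_le_one (by positivity)]
          linarith
    _ = Real.exp (-s) := by
        rw [← Real.exp_nat_mul, ← Real.exp_add, ht]
        congr 1
        field_simp
        ring

end Concentration

/-! ### Least squares -/

section LeastSquares

theorem abs_inner_le_of_norm_le {E : Type*} [NormedAddCommGroup E] [InnerProductSpace ℝ E]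
    {x w : E} {C : ℝ} (hx : ‖x‖ ≤ 1) (hw : ‖w‖ ≤ C) : |inner ℝ x w| ≤ C :=
  (abs_real_inner_le_norm x w).trans <|
    (mul_le_mul hx hw (norm_nonneg _) zero_le_one).trans (one_mul C).le

theorem sq_sub_le_sq_sub_add {u v r η C : ℝ} (huv : |u - v| ≤ η) (hC : |u + v - 2 * r| ≤ C) :
    (u - r) ^ 2 ≤ (v - r) ^ 2 + η * C := by
  have hprod : (u - v) * (u + v - 2 * r) ≤ η * C := by
    refine (le_abs_self _).trans ((abs_mul _ _).trans_le ?_)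
    exact mul_le_mul huv hC (abs_nonneg _) ((abs_nonneg _).trans huv)
  linarith

variable {Ω : Type*} [MeasurableSpace Ω] {m : Measure Ω} {g f q R : Ω → ℝ} {B : ℝ}

theorem integral_excess_loss (hgq : Integrable (fun z => (g z - q z) ^ 2) m)
    (hres : Integrable (fun z => (g z - q z) * (R z - q z)) m)
    (horth : ∫ z, (g z - q z) * (R z - q z) ∂m = 0) :
    ∫ z, ((g z - R z) ^ 2 - (q z - R z) ^ 2) ∂m = ∫ z, (g z - q z) ^ 2 ∂m := by
  have hexpand : ∀ z, (g z - R z) ^ 2 - (q z - R z) ^ 2 =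
      (g z - q z) ^ 2 - 2 * ((g z - q z) * (R z - q z)) := fun z => by ring
  simp_rw [hexpand]
  rw [integral_sub hgq (hres.const_mul 2), integral_const_mul, horth]
  simp

variable [IsProbabilityMeasure m]

theorem integral_sq_sub_le_of_abs_sub_le {η : ℝ} (hfg : ∀ z, |f z - g z| ≤ η)
    (hf : Integrable (fun z => (f z - q z) ^ 2) m) :
    ∫ z, (g z - q z) ^ 2 ∂m ≤ 2 * ∫ z, (f z - q z) ^ 2 ∂m + 2 * η ^ 2 := by
  calc ∫ z, (g z - q z) ^ 2 ∂m ≤ ∫ z, (2 * (f z - q z) ^ 2 + 2 * η ^ 2) ∂m := by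
        refine integral_mono_of_nonneg (.of_forall fun z => sq_nonneg _)
          ((hf.const_mul 2).add (integrable_const _)) (.of_forall fun z => ?_)
        have hη : (f z - g z) ^ 2 ≤ η ^ 2 := sq_le_sq' (abs_le.1 (hfg z)).1 (abs_le.1 (hfg z)).2
        simp only
        nlinarith [sq_nonneg ((f z - q z) + (f z - g z))]
    _ = _ := by
        rw [integral_add (hf.const_mul 2) (integrable_const _), integral_const_mul]
        simp

theorem measure_sum_excess_loss_lt_le (hB : 0 < B) (hg : Measurable g) (hq : Measurable q)
    (hR : Measurable R) (hgB : ∀ z, |g z| ≤ 2 * B) (hqB : ∀ᵐ z ∂m, |q z| ≤ B)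
    (hRB : ∀ᵐ z ∂m, |R z| ≤ B) (horth : ∫ z, (g z - q z) * (R z - q z) ∂m = 0) (n : ℕ) (s : ℝ) :
    (Measure.pi fun _ : Fin n => m)
      {D | ∑ i, ((g (D i) - R (D i)) ^ 2 - (q (D i) - R (D i)) ^ 2) <
        n * (∫ z, (g z - q z) ^ 2 ∂m) / 2 - 50 * B ^ 2 * s} ≤ ENNReal.ofReal (Real.exp (-s)) := by
  have hgq : ∀ᵐ z ∂m, |g z - q z| ≤ 3 * B := by
    filter_upwards [hqB] with z hqz
    exact (abs_sub _ _).trans (by linarith [hgB z])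
  have hsum : ∀ᵐ z ∂m, |g z + q z - 2 * R z| ≤ 5 * B := by
    filter_upwards [hqB, hRB] with z hqz hRz
    refine (abs_sub _ _).trans ?_
    rw [abs_mul, abs_two]
    linarith [abs_add_le (g z) (q z), hgB z]
  have hres : Integrable (fun z => (g z - q z) * (R z - q z)) m := by
    refine .of_bound (by fun_prop) (3 * B * (2 * B)) ?_
    filter_upwards [hgq, hqB, hRB] with z hgqz hqz hRz
    rw [Real.norm_eq_abs, abs_mul]
    gcongr
    exact (abs_sub _ _).trans (by linarith)
  have hgq_sq := integrable_sq_of_abs_le (hg.sub hq) hgq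
  have hmean := integral_excess_loss hgq_sq hres horth
  have hfactor : ∀ z, (g z - R z) ^ 2 - (q z - R z) ^ 2 =
    (g z - q z) * (g z + q z - 2 * R z) := fun z => by ring
  have hbound : ∀ᵐ z ∂m, |(g z - R z) ^ 2 - (q z - R z) ^ 2| ≤ 25 * B ^ 2 := by
    filter_upwards [hsum, hgq] with z hsz hgz
    rw [hfactor, abs_mul]
    nlinarith [mul_le_mul hgz hsz (abs_nonneg _) (by positivity)]
  have hvar : ∫ z, ((g z - R z) ^ 2 - (q z - R z) ^ 2) ^ 2 ∂m ≤
      25 * B ^ 2 * ∫ z, ((g z - R z) ^ 2 - (q z - R z) ^ 2) ∂m := by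
    rw [hmean, ← integral_const_mul]
    refine integral_mono_of_nonneg (.of_forall fun z => sq_nonneg _) (hgq_sq.const_mul _) ?_
    filter_upwards [hsum] with z hz
    rw [hfactor, mul_pow, mul_comm]
    exact mul_le_mul_of_nonneg_right ((sq_le_sq' (abs_le.1 hz).1 (abs_le.1 hz).2).trans
      (by linarith)) (sq_nonneg _)
  have hchernoff := measure_sum_lt_le_of_integral_sq_le (by positivity) (by fun_prop) hbound hvar
    n s
  rwa [hmean, show 2 * (25 * B ^ 2) * s = 50 * B ^ 2 * s by ring] at hchernoff

/-- Reduces the failure of a function `g` to the rare event of `measure_sum_excess_loss_lt_le` for a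
point `f` of a finite net near `g`. -/
theorem sum_excess_loss_lt_of_abs_sub_le {n : ℕ} (hn : 1 ≤ n) (hB : 0 < B) {s : ℝ}
    {D : Fin n → Ω} (hgB : ∀ z, |g z| ≤ B) (hfB : ∀ z, |f z| ≤ 2 * B) (hRB : ∀ j, |R (D j)| ≤ B)
    (hfg : ∀ z, |f z - g z| ≤ B / n) (hf : Integrable (fun z => (f z - q z) ^ 2) m)
    (hloss : ∑ j, (g (D j) - R (D j)) ^ 2 ≤ ∑ j, (q (D j) - R (D j)) ^ 2)
    (hrisk : (22 + 200 * s) * B ^ 2 / n < ∫ z, (g z - q z) ^ 2 ∂m) :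
    ∑ j, ((f (D j) - R (D j)) ^ 2 - (q (D j) - R (D j)) ^ 2) <
      n * (∫ z, (f z - q z) ^ 2 ∂m) / 2 - 50 * B ^ 2 * s := by
  have hn0 : (0 : ℝ) < n := by exact_mod_cast hn
  have hloss_f : ∑ j, (f (D j) - R (D j)) ^ 2 ≤ ∑ j, (g (D j) - R (D j)) ^ 2 + 5 * B ^ 2 := by
    calc _ ≤ ∑ j, ((g (D j) - R (D j)) ^ 2 + B / n * (5 * B)) := by
          refine Finset.sum_le_sum fun j _ => sq_sub_le_sq_sub_add (hfg _) ?_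
          refine (abs_sub _ _).trans ?_
          rw [abs_mul, abs_two]
          linarith [abs_add_le (f (D j)) (g (D j)), hfB (D j), hgB (D j), hRB j]
      _ = _ := by
          rw [Finset.sum_add_distrib, Finset.sum_const, Finset.card_univ, Fintype.card_fin,
            nsmul_eq_mul]
          field_simp
  have hrisk_f : (22 + 200 * s) * B ^ 2 / n <
      2 * ∫ z, (f z - q z) ^ 2 ∂m + 2 * (B / n) ^ 2 :=
    hrisk.trans_le (integral_sq_sub_le_of_abs_sub_le hfg hf)
  have hmesh : (n : ℝ) * (B / n) ^ 2 ≤ B ^ 2 := by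
    have hBn : B / n ≤ B := div_le_self hB.le (by exact_mod_cast hn)
    calc (n : ℝ) * (B / n) ^ 2 = B * (B / n) := by field_simp
      _ ≤ B ^ 2 := by rw [sq]; gcongr
  have hrisk_mul : (22 + 200 * s) * B ^ 2 <
      n * (2 * ∫ z, (f z - q z) ^ 2 ∂m + 2 * (B / n) ^ 2) := by
    rwa [div_lt_iff₀' hn0] at hrisk_f
  rw [Finset.sum_sub_distrib]
  linarith

theorem measure_exists_risk_lt_le {ι : Type*} {f : ι → Ω → ℝ} {G : Set ι} {N : Finset ι}
    {n : ℕ} (hn : 1 ≤ n) (hB : 0 < B) (hG : ∀ i ∈ G, ∀ z, |f i z| ≤ B)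
    (hNm : ∀ i ∈ N, Measurable (f i)) (hNB : ∀ i ∈ N, ∀ z, |f i z| ≤ 2 * B)
    (hGN : ∀ i ∈ G, ∃ j ∈ N, ∀ z, |f j z - f i z| ≤ B / n)
    (hq : Measurable q) (hR : Measurable R) (hqB : ∀ᵐ z ∂m, |q z| ≤ B) (hRB : ∀ᵐ z ∂m, |R z| ≤ B)
    (horth : ∀ i ∈ N, ∫ z, (f i z - q z) * (R z - q z) ∂m = 0) (s : ℝ) :
    (Measure.pi fun _ : Fin n => m)
      {D | ∃ i ∈ G, ∑ j, (f i (D j) - R (D j)) ^ 2 ≤ ∑ j, (q (D j) - R (D j)) ^ 2 ∧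
        (22 + 200 * s) * B ^ 2 / n < ∫ z, (f i z - q z) ^ 2 ∂m} ≤
      ENNReal.ofReal (N.card * Real.exp (-s)) := by
  set bad : ι → Set (Fin n → Ω) := fun i =>
    {D | ∑ j, ((f i (D j) - R (D j)) ^ 2 - (q (D j) - R (D j)) ^ 2) <
      n * (∫ z, (f i z - q z) ^ 2 ∂m) / 2 - 50 * B ^ 2 * s}
  have hRB_sample : ∀ᵐ D ∂(Measure.pi fun _ : Fin n => m), ∀ j, |R (D j)| ≤ B :=
    ae_all_iff.2 fun j => (Measure.quasiMeasurePreserving_eval (fun _ : Fin n => m) j).ae hRB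
  calc _ ≤ (Measure.pi fun _ : Fin n => m) (⋃ i ∈ N, bad i) := by
        refine measure_mono_ae ?_
        filter_upwards [hRB_sample] with D hD
        rintro ⟨i, hi, hloss, hrisk⟩
        obtain ⟨j, hj, hji⟩ := hGN i hi
        have hint : Integrable (fun z => (f j z - q z) ^ 2) m := by
          refine integrable_sq_of_abs_le (b := 3 * B) ((hNm j hj).sub hq) ?_
          filter_upwards [hqB] with z hz
          exact (abs_sub _ _).trans (by linarith [hNB j hj z])
        exact Set.mem_iUnion₂.2 ⟨j, hj, sum_excess_loss_lt_of_abs_sub_le hn hB (hG i hi)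
          (hNB j hj) hD hji hint hloss hrisk⟩
    _ ≤ ∑ i ∈ N, (Measure.pi fun _ : Fin n => m) (bad i) := measure_biUnion_finset_le _ _
    _ ≤ ∑ _i ∈ N, ENNReal.ofReal (Real.exp (-s)) := Finset.sum_le_sum fun i hi =>
        measure_sum_excess_loss_lt_le hB (hNm i hi) hq hR (hNB i hi) hqB hRB (horth i hi) n s
    _ = _ := by
        rw [Finset.sum_const, nsmul_eq_mul, ENNReal.ofReal_mul (Nat.cast_nonneg _),
          ENNReal.ofReal_natCast]

end LeastSquares

section Nets

theorem norm_sub_mesh_floor_le {d : ℕ} {c : ℝ} (hc : 0 < c) (w : EuclideanSpace ℝ (Fin d)) :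
    ‖w - WithLp.toLp 2 fun j => c * ⌊w j / c⌋‖ ≤ c * √d := by
  have hcoord : ∀ j, ‖(w - WithLp.toLp 2 fun j => c * (⌊w j / c⌋ : ℝ)) j‖ ^ 2 ≤ c ^ 2 := by
    intro j
    have hfract : (w - WithLp.toLp 2 fun j => c * (⌊w j / c⌋ : ℝ)) j = c * Int.fract (w j / c) := by
      rw [Int.fract]
      simp only [PiLp.sub_apply]
      field_simp
    rw [hfract, norm_mul, mul_pow, Real.norm_eq_abs, Real.norm_eq_abs, sq_abs, sq_abs]
    exact mul_le_of_le_one_right (sq_nonneg c)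
      (pow_le_one₀ (Int.fract_nonneg _) (Int.fract_lt_one _).le)
  rw [EuclideanSpace.norm_eq]
  refine Real.sqrt_le_iff.2 ⟨by positivity, (Finset.sum_le_sum fun j _ => hcoord j).trans ?_⟩
  rw [mul_pow, Real.sq_sqrt (Nat.cast_nonneg d)]
  simp [mul_comm]

theorem floor_div_mem_Icc {x c B : ℝ} (hc : 0 < c) (hx : |x| ≤ B) :
    ⌊x / c⌋ ∈ Finset.Icc (-(⌈B / c⌉₊ : ℤ)) ⌈B / c⌉₊ := by
  have hceil : B / c ≤ ⌈B / c⌉₊ := Nat.le_ceil _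
  have hx' : |x / c| ≤ B / c := by
    rw [abs_div, abs_of_pos hc]
    gcongr
  rw [Finset.mem_Icc, Int.le_floor, ← Int.cast_le (R := ℝ)]
  push_cast
  exact ⟨by linarith [(abs_le.1 hx').1], by linarith [(abs_le.1 hx').2, Int.floor_le (x / c)]⟩

theorem exists_finset_net_closedBall {d : ℕ} (hd : 1 ≤ d) (B : ℝ) {η : ℝ} (hη : 0 < η) :
    ∃ N : Finset (EuclideanSpace ℝ (Fin d)), N.card ≤ (2 * ⌈B / η * √d⌉₊ + 1) ^ d ∧
      (∀ v ∈ N, ‖v‖ ≤ B + η) ∧ ∀ w, ‖w‖ ≤ B → ∃ v ∈ N, ‖v - w‖ ≤ η := by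
  classical
  have hsqrt : 0 < √(d : ℝ) := Real.sqrt_pos.2 (by exact_mod_cast hd)
  set c := η / √d with hc
  have hc0 : 0 < c := by positivity
  have hBc : B / c = B / η * √d := by rw [hc]; field_simp
  let K := Fintype.piFinset fun _ : Fin d => Finset.Icc (-(⌈B / c⌉₊ : ℤ)) (⌈B / c⌉₊ : ℤ)
  let grid : (Fin d → ℤ) → EuclideanSpace ℝ (Fin d) := fun k => WithLp.toLp 2 fun j => c * k j
  refine ⟨(K.image grid).filter (‖·‖ ≤ B + η), ?_, fun v hv => (Finset.mem_filter.1 hv).2, ?_⟩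
  · calc _ ≤ K.card := (Finset.card_filter_le _ _).trans Finset.card_image_le
      _ = _ := by
        rw [Fintype.card_piFinset_const, Int.card_Icc, hBc]
        congr 1
        omega
  · intro w hw
    have hdist : ‖grid (fun j => ⌊w j / c⌋) - w‖ ≤ η := by
      rw [norm_sub_rev]
      exact (norm_sub_mesh_floor_le hc0 w).trans_eq (div_mul_cancel₀ η hsqrt.ne')
    refine ⟨grid fun j => ⌊w j / c⌋, Finset.mem_filter.2 ⟨Finset.mem_image_of_mem _ ?_, ?_⟩, hdist⟩
    · exact Fintype.mem_piFinset.2 fun j =>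
        floor_div_mem_Icc hc0 ((PiLp.norm_apply_le w j).trans hw)
    · linarith [norm_le_norm_add_norm_sub' (grid fun j => ⌊w j / c⌋) w]

theorem abs_le_of_mem_linearClass {X A : Type*} {d : ℕ}
    {Φ : Finset (X → A → EuclideanSpace ℝ (Fin d))} (hΦ : ∀ φ ∈ Φ, ∀ x a, ‖φ x a‖ ≤ 1) {B : ℝ}
    {g : X → A → ℝ} (hg : g ∈ linearClass Φ B) (x : X) (a : A) : |g x a| ≤ B := by
  obtain ⟨φ, hφ, w, hw, rfl⟩ := hg
  exact abs_inner_le_of_norm_le (hΦ φ hφ x a) hw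

theorem measurable_of_mem_linearClass {X A : Type*} [MeasurableSpace X] {d : ℕ}
    {Φ : Finset (X → A → EuclideanSpace ℝ (Fin d))} (hΦ : ∀ φ ∈ Φ, ∀ a, Measurable fun x => φ x a)
    {B : ℝ} {g : X → A → ℝ} (hg : g ∈ linearClass Φ B) (a : A) : Measurable fun x => g x a := by
  obtain ⟨φ, hφ, w, -, rfl⟩ := hg
  exact (hΦ φ hφ a).inner measurable_const

theorem exists_finset_net_linearClass {X A : Type*} {d : ℕ} (hd : 1 ≤ d)
    {Φ : Finset (X → A → EuclideanSpace ℝ (Fin d))} (hΦ : ∀ φ ∈ Φ, ∀ x a, ‖φ x a‖ ≤ 1) (B : ℝ)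
    {η : ℝ} (hη : 0 < η) :
    ∃ N : Finset (X → A → ℝ), N.card ≤ Φ.card * (2 * ⌈B / η * √d⌉₊ + 1) ^ d ∧
      (∀ f ∈ N, f ∈ linearClass Φ (B + η)) ∧
      ∀ g ∈ linearClass Φ B, ∃ f ∈ N, ∀ x a, |f x a - g x a| ≤ η := by
  classical
  obtain ⟨K, hcard, hnorm, hcover⟩ := exists_finset_net_closedBall hd B hη
  refine ⟨(Φ ×ˢ K).image fun p x a => inner ℝ (p.1 x a) p.2, ?_, ?_, ?_⟩
  · exact Finset.card_image_le.trans
      ((Finset.card_product _ _).trans_le (Nat.mul_le_mul_left _ hcard))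
  · intro f hf
    obtain ⟨⟨φ, v⟩, hp, rfl⟩ := Finset.mem_image.1 hf
    obtain ⟨hφ, hv⟩ := Finset.mem_product.1 hp
    exact ⟨φ, hφ, v, hnorm v hv, rfl⟩
  · rintro g ⟨φ, hφ, w, hw, rfl⟩
    obtain ⟨v, hv, hvw⟩ := hcover w hw
    refine ⟨_, Finset.mem_image_of_mem _ (Finset.mk_mem_product hφ hv), fun x a => ?_⟩
    rw [← inner_sub_right]
    exact abs_inner_le_of_norm_le (hΦ φ hφ x a) hvw

end Nets

section LinearClass

theorem measure_exists_linearClass_risk_lt_le {X A : Type*} [MeasurableSpace X]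
    [MeasurableSpace A] [Countable A] [MeasurableSingletonClass A] {m : Measure (X × A × ℝ)}
    [IsProbabilityMeasure m] {d n : ℕ} (hd : 1 ≤ d) (hn : 1 ≤ n)
    {Φ : Finset (X → A → EuclideanSpace ℝ (Fin d))} (hΦ1 : ∀ φ ∈ Φ, ∀ x a, ‖φ x a‖ ≤ 1)
    (hΦm : ∀ φ ∈ Φ, ∀ a, Measurable fun x => φ x a) {B : ℝ} (hB : 0 < B) {q : X × A → ℝ}
    (hq : Measurable q) (hqB : ∀ p, |q p| ≤ B) (hRB : ∀ᵐ z ∂m, |z.2.2| ≤ B)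
    (horth : ∀ (f : X × A → ℝ) (C : ℝ), Measurable f → (∀ p, |f p| ≤ C) →
      ∫ z, f (z.1, z.2.1) * (z.2.2 - q (z.1, z.2.1)) ∂m = 0) (s : ℝ) :
    (Measure.pi fun _ : Fin n => m)
      {D | ∃ g ∈ linearClass Φ B, ∑ j, (g (D j).1 (D j).2.1 - (D j).2.2) ^ 2 ≤
          ∑ j, (q ((D j).1, (D j).2.1) - (D j).2.2) ^ 2 ∧
        (22 + 200 * s) * B ^ 2 / n < ∫ z, (g z.1 z.2.1 - q (z.1, z.2.1)) ^ 2 ∂m} ≤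
      ENNReal.ofReal (Φ.card * (2 * ⌈(n : ℝ) * √(d : ℝ)⌉₊ + 1 : ℝ) ^ d * Real.exp (-s)) := by
  have hn0 : (0 : ℝ) < n := by exact_mod_cast hn
  obtain ⟨N, hcard, hN, hcover⟩ := exists_finset_net_linearClass hd hΦ1 B (div_pos hB hn0)
  have hNm : ∀ g ∈ N, Measurable fun p : X × A => g p.1 p.2 := fun g hg =>
    measurable_from_prod_countable_left (measurable_of_mem_linearClass hΦm (hN g hg))
  have hNB : ∀ g ∈ N, ∀ x a, |g x a| ≤ 2 * B := fun g hg x a =>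
    (abs_le_of_mem_linearClass hΦ1 (hN g hg) x a).trans
      (by linarith [div_le_self hB.le (by exact_mod_cast hn : (1 : ℝ) ≤ n)])
  have hpair : Measurable fun z : X × A × ℝ => (z.1, z.2.1) := by fun_prop
  refine (measure_exists_risk_lt_le (m := m) (f := fun (g : X → A → ℝ) z => g z.1 z.2.1)
    (G := linearClass Φ B) (N := N) (q := fun z => q (z.1, z.2.1))
    (R := fun z => z.2.2) hn hB (fun g hg z => abs_le_of_mem_linearClass hΦ1 hg _ _)
    (fun g hg => (hNm g hg).comp hpair) (fun g hg z => hNB g hg _ _)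
    (fun g hg => (hcover g hg).imp fun _ h => ⟨h.1, fun z => h.2 _ _⟩) (hq.comp hpair)
    (by fun_prop) (.of_forall fun z => hqB _) hRB (fun g hg =>
      horth (fun p => g p.1 p.2 - q p) (2 * B + B) ((hNm g hg).sub hq)
        fun p => (abs_sub _ _).trans (add_le_add (hNB g hg _ _) (hqB p)))
    s).trans (ENNReal.ofReal_le_ofReal ?_)
  have hmesh : B / (B / n) * √(d : ℝ) = n * √(d : ℝ) := by field_simp
  rw [hmesh] at hcard
  gcongr
  exact_mod_cast hcard

end LinearClass

/-! ### Normalized vector densities -/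

section NormalizedDensity

variable {Ω : Type*} [MeasurableSpace Ω] {m : Measure Ω} {K : ℝ}

theorem norm_integral_smul_le_two_mul {E : Type*} [NormedAddCommGroup E] [NormedSpace ℝ E]
    {F : Ω → E} (hF : Integrable F m)
    (hK : ∀ g : Ω → ℝ, Measurable g → (∀ x, 0 ≤ g x ∧ g x ≤ 1) → ‖∫ x, g x • F x ∂m‖ ≤ K)
    {f : Ω → ℝ} (hf : Measurable f) {C : ℝ} (hC : 0 < C) (hfC : ∀ x, |f x| ≤ C) :
    ‖∫ x, f x • F x ∂m‖ ≤ 2 * C * K := by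
  have hpart : ∀ g : Ω → ℝ, Measurable g → (∀ x, |g x| ≤ C) → (∀ x, 0 ≤ max (g x / C) 0 ∧
      max (g x / C) 0 ≤ 1) ∧ Integrable (fun x => max (g x / C) 0 • F x) m := by
    intro g hg hgC
    have h01 : ∀ x, 0 ≤ max (g x / C) 0 ∧ max (g x / C) 0 ≤ 1 := fun x =>
      ⟨le_max_right _ _, max_le ((div_le_one hC).2 ((le_abs_self _).trans (hgC x))) zero_le_one⟩
    refine ⟨h01, hF.bdd_smul 1 (by fun_prop) (.of_forall fun x => ?_)⟩
    rw [Real.norm_eq_abs, abs_of_nonneg (h01 x).1]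
    exact (h01 x).2
  obtain ⟨hpos01, hpos⟩ := hpart f hf hfC
  obtain ⟨hneg01, hneg⟩ := hpart (fun x => -f x) hf.neg fun x => (abs_neg _).trans_le (hfC x)
  have hsplit : ∫ x, f x • F x ∂m =
      C • (∫ x, max (f x / C) 0 • F x ∂m - ∫ x, max (-f x / C) 0 • F x ∂m) := by
    rw [← integral_sub hpos hneg, ← integral_smul]
    refine integral_congr_ae (.of_forall fun x => ?_)
    simp only [← sub_smul, smul_smul, neg_div, max_zero_sub_max_neg_zero_eq_self]
    rw [mul_div_cancel₀ _ hC.ne']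
  rw [hsplit, norm_smul, Real.norm_eq_abs, abs_of_pos hC, mul_comm 2 C, mul_assoc]
  gcongr
  exact (norm_sub_le _ _).trans (by linarith [hK _ (by fun_prop) hpos01, hK _ (by fun_prop) hneg01])

theorem norm_le_sum_abs {ι : Type*} [Fintype ι] (v : EuclideanSpace ℝ ι) : ‖v‖ ≤ ∑ i, |v i| := by
  rw [EuclideanSpace.norm_eq]
  exact Real.sqrt_le_iff.2
    ⟨by positivity, Finset.sum_sq_le_sq_sum_of_nonneg fun i _ => abs_nonneg (v i)⟩

theorem integral_norm_le_two_mul_card_mul {ι : Type*} [Fintype ι] {F : Ω → EuclideanSpace ℝ ι}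
    (hF : Integrable F m) (hFm : Measurable F)
    (hK : ∀ g : Ω → ℝ, Measurable g → (∀ x, 0 ≤ g x ∧ g x ≤ 1) → ‖∫ x, g x • F x ∂m‖ ≤ K) :
    ∫ x, ‖F x‖ ∂m ≤ 2 * (Fintype.card ι * K) := by
  have hcoord_int : ∀ i, Integrable (fun x => |F x i|) m := fun i =>
    ((EuclideanSpace.proj i : EuclideanSpace ℝ ι →L[ℝ] ℝ).integrable_comp hF).abs
  have hcoord : ∀ i, ∫ x, |F x i| ∂m ≤ 2 * K := by
    intro i
    let s : Ω → ℝ := fun x => if 0 ≤ F x i then 1 else -1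
    have hs : Measurable s :=
      Measurable.ite (measurableSet_le (by fun_prop) (by fun_prop)) (by fun_prop) (by fun_prop)
    have hs1 : ∀ x, |s x| ≤ 1 := fun x => by simp only [s]; split_ifs <;> simp
    have hsF : Integrable (fun x => s x • F x) m := hF.bdd_smul 1 hs.aestronglyMeasurable
      (.of_forall hs1)
    calc ∫ x, |F x i| ∂m = ∫ x, (s x • F x) i ∂m := by
          refine integral_congr_ae (.of_forall fun x => ?_)
          simp only [PiLp.smul_apply, smul_eq_mul, s]
          split_ifs with hx
          · rw [abs_of_nonneg hx, one_mul]
          · rw [abs_of_neg (not_le.1 hx), neg_one_mul]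
      _ = (∫ x, s x • F x ∂m) i :=
          (EuclideanSpace.proj i : EuclideanSpace ℝ ι →L[ℝ] ℝ).integral_comp_comm hsF
      _ ≤ ‖∫ x, s x • F x ∂m‖ := (Real.le_norm_self _).trans (PiLp.norm_apply_le _ i)
      _ ≤ 2 * K := by simpa using norm_integral_smul_le_two_mul hF hK hs one_pos hs1
  calc ∫ x, ‖F x‖ ∂m ≤ ∫ x, ∑ i, |F x i| ∂m :=
        integral_mono hF.norm (integrable_finsetSum _ fun i _ => hcoord_int i)
          fun x => norm_le_sum_abs _
    _ = ∑ i, ∫ x, |F x i| ∂m := integral_finsetSum _ fun i _ => hcoord_int i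
    _ ≤ ∑ _i : ι, 2 * K := Finset.sum_le_sum fun i _ => hcoord i
    _ = _ := by simp only [Finset.sum_const, Finset.card_univ, nsmul_eq_mul]; ring

end NormalizedDensity

/-! ### Greedy actions -/

section Greedy

variable {X A : Type*} [MeasurableSpace X] [MeasurableSpace A]

theorem integral_sqrt_le_sqrt_mul_integral {m : Measure X} [IsFiniteMeasure m] {f : X → ℝ}
    (hf0 : ∀ x, 0 ≤ f x) (hf : Integrable f m) :
    Integrable (fun x => √(f x)) m ∧ ∫ x, √(f x) ∂m ≤ √(m.real Set.univ * ∫ x, f x ∂m) := by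
  have hsq : (fun x => √(f x) ^ 2) = f := funext fun x => Real.sq_sqrt (hf0 x)
  have hmem : MemLp (fun x => √(f x)) 2 m :=
    (memLp_two_iff_integrable_sq
      (Real.continuous_sqrt.comp_aestronglyMeasurable hf.aestronglyMeasurable)).2
      (by simpa only [Real.sq_sqrt (hf0 _)] using hf)
  refine ⟨hmem.integrable (by norm_num), ?_⟩
  have hholder := integral_mul_le_Lp_mul_Lq_of_nonneg (μ := m) (f := fun x => √(f x))
    (g := fun _ => 1) Real.HolderConjugate.two_two (.of_forall fun x => Real.sqrt_nonneg _)
    (.of_forall fun _ => zero_le_one) (by simpa using hmem) (memLp_const 1)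
  simp only [mul_one, Real.rpow_two, one_pow, ← Real.sqrt_eq_rpow, hsq, integral_const,
    smul_eq_mul] at hholder
  rwa [mul_comm, Real.sqrt_mul (integral_nonneg hf0)]

theorem le_add_two_mul_sqrt_sum_sq_sub {ι : Type*} [Fintype ι] {g q : ι → ℝ} {b : ι}
    (hb : ∀ a, g a ≤ g b) (a : ι) : q a ≤ q b + 2 * √(∑ a, (g a - q a) ^ 2) := by
  have hcoord : ∀ a, |g a - q a| ≤ √(∑ a, (g a - q a) ^ 2) := fun a =>
    Real.abs_le_sqrt (Finset.single_le_sum (f := fun a => (g a - q a) ^ 2)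
      (fun a _ => sq_nonneg _) (Finset.mem_univ a))
  linarith [hb a, (abs_le.1 (hcoord a)).1, (abs_le.1 (hcoord b)).2]

theorem setIntegral_sqrt_le_of_restrict_le {s m : Measure X} [IsProbabilityMeasure s]
    {S : Set X} {c : ℝ} (hc : 0 ≤ c) (hS : s.restrict S ≤ ENNReal.ofReal c • m) {f : X → ℝ}
    (hf : Measurable f) (hf0 : ∀ x, 0 ≤ f x) {E : ℝ} (hE : 0 ≤ E)
    (hfE : ∫⁻ x, ENNReal.ofReal (f x) ∂m ≤ ENNReal.ofReal E) :
    IntegrableOn (fun x => √(f x)) S s ∧ ∫ x in S, √(f x) ∂s ≤ √(c * E) := by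
  have hlint : ∫⁻ x in S, ENNReal.ofReal (f x) ∂s ≤ ENNReal.ofReal (c * E) := by
    refine (lintegral_mono' hS le_rfl).trans ?_
    rw [lintegral_smul_measure, ENNReal.ofReal_mul hc]
    exact mul_le_mul_right hfE _
  have hint : IntegrableOn f S s := ⟨hf.aestronglyMeasurable,
    (hasFiniteIntegral_iff_ofReal (.of_forall hf0)).2 (hlint.trans_lt ENNReal.ofReal_lt_top)⟩
  obtain ⟨hsqrt, hle⟩ := integral_sqrt_le_sqrt_mul_integral hf0 hint
  refine ⟨hsqrt, hle.trans (Real.sqrt_le_sqrt ?_)⟩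
  rw [← ofReal_integral_eq_lintegral_ofReal hint (.of_forall hf0),
    ENNReal.ofReal_le_ofReal_iff (by positivity)] at hlint
  refine (mul_le_of_le_one_left (integral_nonneg hf0) ?_).trans hlint
  rw [measureReal_restrict_apply_univ]
  exact measureReal_le_one

theorem integral_compProd_le_of_le_comp_fst {s : Measure X} [SFinite s] (κ : Kernel X A)
    [IsMarkovKernel κ] {q : X × A → ℝ} {u : X → ℝ} (hq : Integrable q (s ⊗ₘ κ))
    (hu : Integrable u s) (hqu : ∀ p, q p ≤ u p.1) :
    ∫ p, q p ∂(s ⊗ₘ κ) ≤ ∫ x, u x ∂s := by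
  have hfst : MeasurePreserving Prod.fst (s ⊗ₘ κ) s := ⟨measurable_fst, Measure.fst_compProd s κ⟩
  refine (integral_mono hq (hfst.integrable_comp_of_integrable hu) hqu).trans_eq ?_
  rw [← hfst.map_eq, integral_map measurable_fst.aemeasurable
    (by rw [hfst.map_eq]; exact hu.aestronglyMeasurable), hfst.map_eq]
  rfl

theorem integral_compProd_le_integral_greedy [Fintype A] {s m : Measure X}
    [IsProbabilityMeasure s] (κ : Kernel X A) [IsMarkovKernel κ] {S : Set X} (hS : MeasurableSet S)
    {c : ℝ} (hc : 0 ≤ c) (hSm : s.restrict S ≤ ENNReal.ofReal c • m) {q : X × A → ℝ}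
    (hq : Measurable q) {b : ℝ} (hqb : ∀ p, |q p| ≤ b) {g : X → A → ℝ}
    (hg : ∀ a, Measurable fun x => g x a) {act : X → A} (hact : Measurable act)
    (hmax : ∀ x a, g x a ≤ g x (act x)) {E : ℝ} (hE : 0 ≤ E)
    (herr : ∫⁻ x, ∑ a, ENNReal.ofReal ((g x a - q (x, a)) ^ 2) ∂m ≤ ENNReal.ofReal E) :
    ∫ p, q p ∂(s ⊗ₘ κ) ≤
      ∫ x, q (x, act x) ∂s + (2 * √(c * E) + 2 * b * s.real Sᶜ) := by
  let f : X → ℝ := fun x => ∑ a, (g x a - q (x, a)) ^ 2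
  have hf : Measurable f := by fun_prop
  obtain ⟨hsqrt_int, hsqrt⟩ := setIntegral_sqrt_le_of_restrict_le hc hSm hf
    (fun x => Finset.sum_nonneg fun a _ => sq_nonneg _) hE
    (by simpa only [f, ENNReal.ofReal_sum_of_nonneg fun _ _ => sq_nonneg _] using herr)
  let u : X → ℝ := fun x => q (x, act x) +
    (S.indicator (fun x => 2 * √(f x)) x + Sᶜ.indicator (fun _ => 2 * b) x)
  have hqu : ∀ p : X × A, q p ≤ u p.1 := by
    rintro ⟨x, a⟩
    by_cases hx : x ∈ S
    · simpa [u, hx] using le_add_two_mul_sqrt_sum_sq_sub (q := fun a => q (x, a)) (hmax x) a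
    · simp only [u, hx, Set.indicator_of_notMem, not_false_eq_true, Set.mem_compl_iff,
        Set.indicator_of_mem, zero_add]
      linarith [(abs_le.1 (hqb (x, a))).2, (abs_le.1 (hqb (x, act x))).1]
  have hgreedy : Integrable (fun x => q (x, act x)) s :=
    .of_bound (hq.comp (measurable_id.prodMk hact)).aestronglyMeasurable b
      (.of_forall fun x => hqb _)
  have hin : Integrable (S.indicator fun x => 2 * √(f x)) s :=
    IntegrableOn.integrable_indicator (Integrable.const_mul hsqrt_int 2) hS
  have hout : Integrable (Sᶜ.indicator fun _ => 2 * b) s :=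
    (integrable_const _).indicator hS.compl
  calc ∫ p, q p ∂(s ⊗ₘ κ) ≤ ∫ x, u x ∂s := integral_compProd_le_of_le_comp_fst κ
        (.of_bound hq.aestronglyMeasurable b (.of_forall hqb)) (hgreedy.add (hin.add hout)) hqu
    _ = ∫ x, q (x, act x) ∂s + (∫ x, S.indicator (fun x => 2 * √(f x)) x ∂s +
          ∫ x, Sᶜ.indicator (fun _ => 2 * b) x ∂s) := by
        rw [← integral_add hin hout]
        exact integral_add hgreedy (hin.add hout)
    _ = ∫ x, q (x, act x) ∂s + (2 * ∫ x in S, √(f x) ∂s + 2 * b * s.real Sᶜ) := by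
        rw [integral_indicator hS, integral_const_mul, integral_indicator hS.compl,
          setIntegral_const, smul_eq_mul, mul_comm (2 * b)]
    _ ≤ _ := by gcongr

end Greedy

/-! ### Kernels and product laws -/

section ParametricLaws

variable {α β γ : Type*} [MeasurableSpace α] [MeasurableSpace β] [MeasurableSpace γ]

theorem integral_measure_comp {E : Type*} [NormedAddCommGroup E] [NormedSpace ℝ E] {m : Measure α}
    [SFinite m] {κ : Kernel α β} [IsSFiniteKernel κ] {f : β → E} (hf : Integrable f (κ ∘ₘ m)) :
    ∫ y, f y ∂(κ ∘ₘ m) = ∫ x, ∫ y, f y ∂(κ x) ∂m := by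
  rw [Measure.comp_eq_comp_const_apply] at hf ⊢
  rw [Kernel.integral_comp hf, Kernel.const_apply]

theorem measurable_finCons (k : ℕ) :
    Measurable fun p : α × (Fin k → α) => Fin.cons (α := fun _ => α) p.1 p.2 := by
  refine measurable_pi_iff.2 (Fin.cases ?_ fun j => ?_)
  · simpa only [Fin.cons_zero] using measurable_fst
  · simp only [Fin.cons_succ]
    fun_prop

theorem measurable_pi_const (n : ℕ) {m : α → Measure β} (hm : Measurable m)
    [∀ a, IsProbabilityMeasure (m a)] :
    Measurable fun a => Measure.pi fun _ : Fin n => m a := by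
  refine Measurable.measure_of_isPiSystem_of_isProbabilityMeasure generateFrom_pi.symm
    isPiSystem_pi ?_
  rintro _ ⟨s, hs, rfl⟩
  simp only [Set.mem_pi, Set.mem_univ, forall_true_left, Set.mem_ofPred_eq] at hs
  simp_rw [Measure.pi_pi]
  exact Finset.measurable_prod _ fun i _ => (Measure.measurable_coe (hs i)).comp hm

theorem bind_map_apply (m : Measure α) (κ : Kernel α β) [IsSFiniteKernel κ] {f : β × α → γ}
    (hf : Measurable f) {s : Set γ} (hs : MeasurableSet s) :
    (m.bind fun a => (κ a).map fun b => f (b, a)) s = ∫⁻ a, κ a {b | f (b, a) ∈ s} ∂m := by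
  have hmap : ∀ a, ∀ {s : Set γ}, MeasurableSet s →
      ((κ a).map fun b => f (b, a)) s = κ a {b | f (b, a) ∈ s} := fun a s hs =>
    Measure.map_apply (hf.comp measurable_prodMk_right) hs
  have hbind : Measurable fun a => (κ a).map fun b => f (b, a) := by
    refine Measure.measurable_of_measurable_coe _ fun s hs => ?_
    simp_rw [hmap _ hs]
    exact Kernel.measurable_kernel_prodMk_left (κ := κ) (t := {p | f (p.2, p.1) ∈ s})
      ((hf.comp measurable_swap) hs)
  rw [Measure.bind_apply hs hbind.aemeasurable]
  simp_rw [hmap _ hs]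

end ParametricLaws

instance {A : Type*} [MeasurableSpace A] [MeasurableSingletonClass A] [Finite A] [Nonempty A] :
    IsProbabilityMeasure (uniformOn (Set.univ : Set A)) :=
  isProbabilityMeasure_uniformOn Set.finite_univ Set.univ_nonempty

theorem lintegral_sum_eq_card_mul_lintegral_prod_uniformOn {X A : Type*} [MeasurableSpace X]
    [MeasurableSpace A] [Fintype A] [MeasurableSingletonClass A] [Nonempty A] (m : Measure X)
    [SFinite m] {f : X × A → ENNReal} (hf : Measurable f) :
    ∫⁻ x, ∑ a, f (x, a) ∂m =
      Fintype.card A * ∫⁻ p, f p ∂(m.prod (uniformOn (Set.univ : Set A))) := by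
  have hcard : (Fintype.card A : ENNReal) ≠ 0 := Nat.cast_ne_zero.2 Fintype.card_ne_zero
  have hunif : ∀ x, ∫⁻ a, f (x, a) ∂(uniformOn Set.univ) =
      (Fintype.card A : ENNReal)⁻¹ * ∑ a, f (x, a) := by
    intro x
    rw [lintegral_fintype, Finset.mul_sum]
    refine Finset.sum_congr rfl fun a _ => ?_
    rw [uniformOn_univ, Measure.count_singleton, one_div, mul_comm]
  simp_rw [lintegral_prod f hf.aemeasurable, hunif]
  rw [lintegral_const_mul _ (by fun_prop), ← mul_assoc,
    ENNReal.mul_inv_cancel hcard (ENNReal.natCast_ne_top _), one_mul]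

theorem sum_filter_le_eq_sum_fin {N : Type*} [AddCommMonoid N] {H : ℕ} (g : Fin H → N)
    (t : Fin H) {k : ℕ} (hk : (t : ℕ) + k = H) :
    ∑ l with t ≤ l, g l = ∑ i : Fin k, g ⟨t + i, by omega⟩ := by
  refine (Finset.sum_bij (fun (i : Fin k) _ => (⟨t + i, by omega⟩ : Fin H)) ?_ ?_ ?_ ?_).symm
  · exact fun i _ => Finset.mem_filter.2 ⟨Finset.mem_univ _, Fin.le_def.2 (Nat.le_add_right _ _)⟩
  · exact fun i _ j _ h => Fin.ext (by simpa using congrArg Fin.val h)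
  · intro l hl
    have htl : (t : ℕ) ≤ l := (Finset.mem_filter.1 hl).2
    exact ⟨⟨l - t, by omega⟩, Finset.mem_univ _, Fin.ext (by simp only; omega)⟩
  · exact fun _ _ => rfl

theorem abs_sum_comp_le {α : Type*} {r : α → ℝ} (h1 : ∀ p, |r p| ≤ 1) {k : ℕ} (τ : Fin k → α) :
    |∑ i, r (τ i)| ≤ k :=
  (Finset.abs_sum_le_sum_abs _ _).trans
    ((Finset.sum_le_sum fun i _ => h1 (τ i)).trans (by simp))

/-! ### Measurable families of policies -/

section Family

variable {X A Z : Type*} [MeasurableSpace X] [MeasurableSpace A] [MeasurableSpace Z] {d H : ℕ}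

instance Policy.isMarkovKernel (π : Policy X A) : IsMarkovKernel π.1 := π.2

/-- The policies `π z` depend measurably on the parameter `z`, jointly with the state. This is what
makes the laws of the data measurable in the randomly chosen, or learned, policy. -/
def IsMeasurableFamily (π : Z → Policy X A) : Prop :=
  Measurable fun p : Z × X => (π p.1).1 p.2

theorem isMeasurableFamily_const (π : Policy X A) : IsMeasurableFamily fun _ : Z => π :=
  π.1.measurable.comp measurable_snd

theorem PolicyDist.isMeasurableFamily_policy (P : PolicyDist X A) : IsMeasurableFamily P.policy :=
  P.kernel.measurable

theorem IsMeasurableFamily.comp {Y : Type*} [MeasurableSpace Y] {π : Z → Policy X A}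
    (hπ : IsMeasurableFamily π) {f : Y → Z} (hf : Measurable f) :
    IsMeasurableFamily fun y => π (f y) :=
  Measurable.comp hπ ((hf.comp measurable_fst).prodMk measurable_snd)

namespace LowRankMDP

theorem concat_apply_of_lt [Nonempty A] (M : LowRankMDP X A d H) (π π' : Policy X A) {t : ℕ}
    {x : X} (hx : (M.layer x : ℕ) < t) : (concat M π t π').1 x = π.1 x := by
  simp [concat, Kernel.piecewise_apply, hx]

theorem concat_apply_of_le [Nonempty A] (M : LowRankMDP X A d H) (π π' : Policy X A) {t : ℕ}
    {x : X} (hx : t ≤ (M.layer x : ℕ)) : (concat M π t π').1 x = π'.1 x := by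
  simp [concat, Kernel.piecewise_apply, not_lt.2 hx]

end LowRankMDP

open Classical in
theorem IsMeasurableFamily.concat [Nonempty A] (M : LowRankMDP X A d H) {π π' : Z → Policy X A}
    (hπ : IsMeasurableFamily π) (hπ' : IsMeasurableFamily π') (t : ℕ) :
    IsMeasurableFamily fun z => concat M (π z) t (π' z) := by
  have hs : MeasurableSet {p : Z × X | (M.layer p.2 : ℕ) < t} :=
    (M.layer_measurable.comp measurable_snd)
      (MeasurableSet.of_discrete (s := {j : Fin H | (j : ℕ) < t}))
  have eq_ite : (fun p : Z × X => (LowRank.concat M (π p.1) t (π' p.1)).1 p.2) =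
      fun p => if (M.layer p.2 : ℕ) < t then (π p.1).1 p.2 else (π' p.1).1 p.2 := by
    funext p
    simp only [LowRank.concat, Kernel.piecewise_apply, Set.mem_ofPred_eq]
  rw [IsMeasurableFamily, eq_ite]
  exact Measurable.ite hs hπ hπ'

theorem IsMeasurableFamily.rollout (M : LowRankMDP X A d H) {π : Z → Policy X A}
    (hπ : IsMeasurableFamily π) (k : ℕ) : Measurable fun p : Z × X => M.rollout (π p.1) k p.2 := by
  induction k with
  | zero => simp only [LowRankMDP.rollout, Kernel.const_apply]; exact measurable_const
  | succ k ih =>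
    refine Measure.measurable_of_measurable_coe _ fun s hs => ?_
    have hi : Measurable (s.indicator (1 : (Fin (k + 1) → X × A) → ENNReal)) :=
      measurable_one.indicator hs
    simp_rw [← lintegral_indicator_one hs, LowRankMDP.lintegral_rollout_succ _ _ _ _ hi]
    let κ : Kernel (Z × X) A := ⟨_, hπ⟩
    let R : Kernel (Z × X) (Fin k → X × A) := ⟨_, ih⟩
    have : IsMarkovKernel κ := ⟨fun p => (π p.1).2.isProbabilityMeasure p.2⟩
    have : IsMarkovKernel R := ⟨fun p => (M.rollout_markov (π p.1) k).isProbabilityMeasure p.2⟩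
    have hT : Measurable fun q : (Z × X) × A => (q.1.2, q.2) := by fun_prop
    have hR : Measurable fun q : ((Z × X) × A) × X => (q.1.1.1, q.2) := by fun_prop
    have hcons : Measurable fun q : (((Z × X) × A) × X) × (Fin k → X × A) =>
        Fin.cons (α := fun _ => X × A) (q.1.1.1.2, q.1.1.2) q.2 :=
      LowRankMDP.measurable_cons.comp
        (f := fun q : (((Z × X) × A) × X) × (Fin k → X × A) => ((q.1.1.1.2, q.1.1.2), q.2))
        (by fun_prop)
    exact ((((hi.comp hcons).lintegral_kernel_prod_right' (κ := R.comap _ hR)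
      ).lintegral_kernel_prod_right' (κ := M.T.comap _ hT)).lintegral_kernel_prod_right' (κ := κ))

theorem IsMeasurableFamily.trajLaw (M : LowRankMDP X A d H) {π : Z → Policy X A}
    (hπ : IsMeasurableFamily π) : Measurable fun z => M.trajLaw (π z) := by
  refine Measure.measurable_of_measurable_coe _ fun s hs => ?_
  simp_rw [LowRankMDP.trajLaw, Measure.bind_apply hs (Kernel.aemeasurable _)]
  exact Measurable.lintegral_prod_right ((Measure.measurable_coe hs).comp (hπ.rollout M H))

end Family

/-! ### State laws -/

namespace LowRankMDP

section StateLaw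

variable {X A : Type*} [MeasurableSpace X] [MeasurableSpace A] {d H : ℕ}

theorem measurableSet_layer (M : LowRankMDP X A d H) (t : Fin H) :
    MeasurableSet {x | M.layer x = t} :=
  M.layer_measurable (measurableSet_singleton t)

theorem ae_forall_layer (M : LowRankMDP X A d H) (π : Policy X A) :
    ∀ᵐ τ ∂(M.trajLaw π), ∀ h : Fin H, M.layer (τ h).1 = h :=
  ae_all_iff.2 fun h => M.ae_layer π h h.2

/-- The transition kernel of the Markov chain of the states when `π` is played. -/
def stepKernel (M : LowRankMDP X A d H) (π : Policy X A) : Kernel X X :=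
  M.T ∘ₖ (Kernel.id ×ₖ π.1)

instance (M : LowRankMDP X A d H) (π : Policy X A) : IsMarkovKernel (M.stepKernel π) := by
  unfold stepKernel; infer_instance

/-- The law of the state after `t` steps. For `t < H` it is `stateLaw`, but it is defined through
the transition kernel instead of the law of the whole trajectory. -/
def stateAt (M : LowRankMDP X A d H) (π : Policy X A) : ℕ → Measure X
  | 0 => M.ρ
  | t + 1 => (stateAt M π t).bind (M.stepKernel π)

instance (M : LowRankMDP X A d H) (π : Policy X A) (t : ℕ) :
    IsProbabilityMeasure (M.stateAt π t) := by
  induction t with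
  | zero => exact M.ρ_prob
  | succ t ih => rw [stateAt]; infer_instance

theorem map_tail_rollout (M : LowRankMDP X A d H) (π : Policy X A) (k : ℕ) :
    (M.rollout π (k + 1)).map (fun τ i => τ i.succ) = M.rollout π k ∘ₖ M.stepKernel π := by
  have htail : Measurable fun (τ : Fin (k + 1) → X × A) (i : Fin k) => τ i.succ := by fun_prop
  rw [rollout, ← Kernel.map_comp_right _ measurable_cons htail]
  change Kernel.map _ Prod.snd = _
  rw [Kernel.map_comp, ← Kernel.snd_eq, Kernel.snd_prod, stepKernel, Kernel.comp_assoc]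

theorem map_suffix_trajLaw (M : LowRankMDP X A d H) (π : Policy X A) {t k : ℕ} (h : t + k = H) :
    (M.trajLaw π).map (fun τ (i : Fin k) => τ ⟨t + i, by omega⟩) =
      (M.stateAt π t).bind (M.rollout π k) := by
  induction t generalizing k with
  | zero =>
    obtain rfl : k = H := by omega
    simp only [zero_add, Fin.eta, Measure.map_id', stateAt, trajLaw]
  | succ t ih =>
    have hsuffix : Measurable fun (τ : Fin H → X × A) (i : Fin (k + 1)) =>
        τ ⟨t + i, by omega⟩ := by fun_prop
    have htail : Measurable fun (τ : Fin (k + 1) → X × A) (i : Fin k) => τ i.succ := by fun_prop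
    have hcomp : (fun (τ : Fin H → X × A) (i : Fin k) => τ ⟨t + 1 + i, by omega⟩) =
        (fun τ i => τ i.succ) ∘ fun τ (i : Fin (k + 1)) => τ ⟨t + i, by omega⟩ := by
      funext τ i
      simp only [Function.comp_apply, Fin.val_succ, add_assoc, add_comm 1]
    rw [hcomp, ← Measure.map_map htail hsuffix, ih (by omega), Measure.map_comp _ _ htail,
      map_tail_rollout, ← Measure.comp_assoc, stateAt]

theorem map_head_rollout (M : LowRankMDP X A d H) (π : Policy X A) (k : ℕ) :
    (M.rollout π (k + 1)).map (fun τ => (τ 0).1) = Kernel.id := by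
  refine Kernel.ext fun x => Measure.ext_of_lintegral _ fun f hf => ?_
  rw [Kernel.lintegral_map _ (by fun_prop) _ hf, lintegral_rollout_zero _ _ _ _ hf,
    Kernel.id_apply, lintegral_dirac' _ hf]

theorem stateLaw_eq_stateAt (M : LowRankMDP X A d H) (π : Policy X A) (t : Fin H) :
    M.stateLaw π t = M.stateAt π t := by
  obtain ⟨k, hk⟩ : ∃ k, (t : ℕ) + (k + 1) = H := ⟨H - t - 1, by omega⟩
  have hsuffix : Measurable fun (τ : Fin H → X × A) (i : Fin (k + 1)) =>
      τ ⟨t + i, by omega⟩ := by fun_prop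
  calc M.stateLaw π t
      = ((M.trajLaw π).map fun τ (i : Fin (k + 1)) => τ ⟨t + i, by omega⟩).map
          fun τ => (τ 0).1 := by rw [Measure.map_map (by fun_prop) hsuffix]; rfl
    _ = M.stateAt π t := by
      rw [map_suffix_trajLaw M π hk, Measure.map_comp _ _ (by fun_prop),
        map_head_rollout, Measure.id_comp]

theorem stateAt_layer (M : LowRankMDP X A d H) (π : Policy X A) (t : Fin H) :
    ∀ᵐ x ∂(M.stateAt π t), M.layer x = t := by
  rw [← stateLaw_eq_stateAt, stateLaw,
    ae_map_iff (Measurable.aemeasurable (by fun_prop)) (M.measurableSet_layer t)]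
  exact M.ae_layer π t t.2

theorem stateAt_congr (M : LowRankMDP X A d H) {π π' : Policy X A} {t : ℕ} (ht : t < H)
    (h : ∀ x, (M.layer x : ℕ) < t → π.1 x = π'.1 x) : M.stateAt π t = M.stateAt π' t := by
  induction t with
  | zero => rfl
  | succ t ih =>
    rw [stateAt, stateAt, ← ih (by omega) fun x hx => h x (by omega)]
    refine Measure.bind_congr_right ?_
    filter_upwards [M.stateAt_layer π ⟨t, by omega⟩] with x hx
    rw [stepKernel, stepKernel, Kernel.comp_apply, Kernel.comp_apply, Kernel.prod_apply,
      Kernel.prod_apply, h x (by rw [hx]; simp)]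

theorem rollout_congr (M : LowRankMDP X A d H) {π π' : Policy X A} {j : ℕ}
    (h : ∀ x, j ≤ (M.layer x : ℕ) → π.1 x = π'.1 x) {k : ℕ} {x : X} (hx : j ≤ (M.layer x : ℕ))
    (hk : (M.layer x : ℕ) + k ≤ H) : M.rollout π k x = M.rollout π' k x := by
  induction k generalizing x with
  | zero => rfl
  | succ k ih =>
    refine Measure.ext_of_lintegral _ fun f hf => ?_
    rw [lintegral_rollout_succ _ _ _ _ hf, lintegral_rollout_succ _ _ _ _ hf, h x hx]
    refine lintegral_congr fun a => ?_
    rcases Nat.eq_zero_or_pos k with rfl | hk'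
    · rfl
    refine lintegral_congr_ae ?_
    filter_upwards [M.T_layer x a (by omega)] with y hy
    rw [ih (by omega) (by omega)]

theorem comp_rollout_congr (M : LowRankMDP X A d H) {π π' : Policy X A} {j : ℕ}
    (h : ∀ x, j + 1 ≤ (M.layer x : ℕ) → π.1 x = π'.1 x) {k : ℕ} {x : X}
    (hx : (M.layer x : ℕ) = j) (hk : j + 1 + k ≤ H) (a : A) :
    (M.T (x, a)).bind (M.rollout π k) = (M.T (x, a)).bind (M.rollout π' k) := by
  rcases Nat.eq_zero_or_pos k with rfl | hk'
  · rfl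
  refine Measure.bind_congr_right ?_
  filter_upwards [M.T_layer x a (by omega)] with y hy
  exact rollout_congr M h (by omega) (by omega)

end StateLaw

/-! ### Returns and values -/

section Value

variable {X A : Type*} [MeasurableSpace X] [MeasurableSpace A] {d H : ℕ}

/-- The law of the return over `k + 1` steps from a state-action pair, when `π` is played from the
second step on. -/
def returnKernel (M : LowRankMDP X A d H) (r : X × A → ℝ) (π : Policy X A) (k : ℕ) :
    Kernel (X × A) ℝ :=
  (Kernel.id ×ₖ (M.rollout π k ∘ₖ M.T)).map fun q => r q.1 + ∑ i, r (q.2 i)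

/-- The value function: the expected sum of the rewards `r` over the next `k` steps. -/
def rolloutValue (M : LowRankMDP X A d H) (r : X × A → ℝ) (π : Policy X A) (k : ℕ) (x : X) : ℝ :=
  ∫ τ, ∑ i, r (τ i) ∂(M.rollout π k x)

/-- The action-value function: the expected sum of the rewards `r` over the next `k + 1` steps,
when the first action is given. -/
def qValue (M : LowRankMDP X A d H) (r : X × A → ℝ) (π : Policy X A) (k : ℕ) (p : X × A) : ℝ :=
  r p + ∫ y, M.rolloutValue r π k y ∂(M.T p)

variable (M : LowRankMDP X A d H) {r : X × A → ℝ}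

theorem measurable_sum_reward (hr : Measurable r) (k : ℕ) :
    Measurable fun τ : Fin k → X × A => ∑ i, r (τ i) := by fun_prop

theorem integrable_sum_reward (hr : Measurable r) (h1 : ∀ p, |r p| ≤ 1) {k : ℕ}
    (m : Measure (Fin k → X × A)) [IsFiniteMeasure m] : Integrable (fun τ => ∑ i, r (τ i)) m :=
  .of_bound (measurable_sum_reward hr k).aestronglyMeasurable k
    (.of_forall fun τ => abs_sum_comp_le h1 τ)

theorem measurable_return (hr : Measurable r) (k : ℕ) :
    Measurable fun q : (X × A) × (Fin k → X × A) => r q.1 + ∑ i, r (q.2 i) := by fun_prop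

theorem isMarkovKernel_returnKernel (hr : Measurable r) (π : Policy X A) (k : ℕ) :
    IsMarkovKernel (M.returnKernel r π k) :=
  Kernel.IsMarkovKernel.map _ (measurable_return hr k)

theorem measurable_rolloutValue (hr : Measurable r) (π : Policy X A) (k : ℕ) :
    Measurable (M.rolloutValue r π k) :=
  (StronglyMeasurable.integral_kernel (measurable_sum_reward hr k).stronglyMeasurable).measurable

theorem abs_rolloutValue_le (h1 : ∀ p, |r p| ≤ 1) (π : Policy X A) (k : ℕ) (x : X) :
    |M.rolloutValue r π k x| ≤ k := by
  simpa [rolloutValue] using norm_integral_le_of_norm_le_const (μ := M.rollout π k x)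
    (f := fun τ => ∑ i, r (τ i)) (.of_forall fun τ => abs_sum_comp_le h1 τ)

theorem integrable_rolloutValue (hr : Measurable r) (h1 : ∀ p, |r p| ≤ 1) (π : Policy X A) (k : ℕ)
    (m : Measure X) [IsFiniteMeasure m] : Integrable (M.rolloutValue r π k) m :=
  .of_bound (M.measurable_rolloutValue hr π k).aestronglyMeasurable k
    (.of_forall fun y => M.abs_rolloutValue_le h1 π k y)

theorem measurable_qValue (hr : Measurable r) (π : Policy X A) (k : ℕ) :
    Measurable (M.qValue r π k) :=
  hr.add (StronglyMeasurable.integral_kernel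
    (M.measurable_rolloutValue hr π k).stronglyMeasurable).measurable

theorem abs_qValue_le (h1 : ∀ p, |r p| ≤ 1) (π : Policy X A) (k : ℕ) (p : X × A) :
    |M.qValue r π k p| ≤ k + 1 := by
  have hint : |∫ y, M.rolloutValue r π k y ∂(M.T p)| ≤ k := by
    simpa using norm_integral_le_of_norm_le_const (μ := M.T p)
      (f := M.rolloutValue r π k) (.of_forall fun y => M.abs_rolloutValue_le h1 π k y)
  exact (abs_add_le _ _).trans (by linarith [h1 p])

theorem integral_returnKernel (hr : Measurable r) (h1 : ∀ p, |r p| ≤ 1) (π : Policy X A) (k : ℕ)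
    (p : X × A) : ∫ s, s ∂(M.returnKernel r π k p) = M.qValue r π k p := by
  have hret := measurable_return hr k
  have hsum : ∀ m : Measure (Fin k → X × A), [IsFiniteMeasure m] →
    Integrable (fun τ => ∑ i, r (τ i)) m := fun m _ => integrable_sum_reward hr h1 m
  rw [returnKernel, Kernel.map_apply _ hret, integral_map hret.aemeasurable (by fun_prop),
    Kernel.prod_apply, Kernel.id_apply, Measure.dirac_prod,
    integral_map (by fun_prop) hret.aestronglyMeasurable]
  simp only
  rw [integral_add (integrable_const _) (hsum _), Kernel.integral_comp (hsum _)]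
  simp [qValue, rolloutValue]

theorem abs_returnKernel_le (hr : Measurable r) (h1 : ∀ p, |r p| ≤ 1) (π : Policy X A) (k : ℕ)
    (p : X × A) : ∀ᵐ s ∂(M.returnKernel r π k p), |s| ≤ (k : ℝ) + 1 := by
  rw [returnKernel, Kernel.map_apply _ (measurable_return hr k),
    ae_map_iff (measurable_return hr k).aemeasurable (measurableSet_le (by fun_prop) (by fun_prop))]
  exact .of_forall fun q => (abs_add_le _ _).trans (by linarith [h1 q.1, abs_sum_comp_le h1 q.2])

theorem map_return_rollout (hr : Measurable r) (π : Policy X A) (k : ℕ) :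
    (M.rollout π (k + 1)).map (fun τ => (τ 0, ∑ i, r (τ i))) =
      (Kernel.id ×ₖ M.returnKernel r π k) ∘ₖ (Kernel.id ×ₖ π.1) := by
  have hret := measurable_return hr k
  have := M.isMarkovKernel_returnKernel hr π k
  rw [rollout, ← Kernel.map_comp_right _ measurable_cons (by fun_prop), Kernel.map_comp]
  congr 1
  simp only [Function.comp_def, Fin.cons_zero, Fin.sum_univ_succ, Fin.cons_succ]
  refine Kernel.ext fun p => Measure.ext_of_lintegral _ fun f hf => ?_
  rw [Kernel.lintegral_map _ (by fun_prop) _ hf, Kernel.lintegral_id_prod hf, returnKernel,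
    Kernel.lintegral_id_prod (by fun_prop), Kernel.lintegral_map _ hret _ (by fun_prop),
    Kernel.lintegral_id_prod (by fun_prop)]

theorem rolloutValue_zero (r : X × A → ℝ) (π : Policy X A) (x : X) :
    M.rolloutValue r π 0 x = 0 := by simp [rolloutValue]

theorem rolloutValue_succ (hr : Measurable r) (h1 : ∀ p, |r p| ≤ 1) (π : Policy X A) (k : ℕ)
    (x : X) : M.rolloutValue r π (k + 1) x = ∫ a, M.qValue r π k (x, a) ∂(π.1 x) := by
  have := measurable_sum_reward hr (k + 1)
  have hpair : Measurable fun τ : Fin (k + 1) → X × A => (τ 0, ∑ i, r (τ i)) := by fun_prop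
  have := M.isMarkovKernel_returnKernel hr π k
  have hint : Integrable (fun q : (X × A) × ℝ => q.2)
      (((Kernel.id ×ₖ M.returnKernel r π k) ∘ₖ (Kernel.id ×ₖ π.1)) x) := by
    rw [← map_return_rollout M hr, Kernel.map_apply _ hpair,
      integrable_map_measure (by fun_prop) hpair.aemeasurable]
    exact integrable_sum_reward hr h1 _
  calc M.rolloutValue r π (k + 1) x
      = ∫ q, q.2 ∂(((M.rollout π (k + 1)).map fun τ => (τ 0, ∑ i, r (τ i))) x) := by
        rw [Kernel.map_apply _ hpair, integral_map hpair.aemeasurable (by fun_prop)]; rfl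
    _ = ∫ p, M.qValue r π k p ∂((Kernel.id ×ₖ π.1) x) := by
        rw [map_return_rollout M hr, Kernel.integral_comp hint]
        refine integral_congr_ae (.of_forall fun p => ?_)
        rw [← M.integral_returnKernel hr h1]
        simp only [Kernel.prod_apply, Kernel.id_apply, Measure.dirac_prod]
        rw [integral_map (by fun_prop) (by fun_prop)]
    _ = ∫ a, M.qValue r π k (x, a) ∂(π.1 x) := by
        rw [Kernel.prod_apply, Kernel.id_apply, Measure.dirac_prod,
          integral_map (by fun_prop) (M.measurable_qValue hr π k).aestronglyMeasurable]

theorem returnKernel_congr (hr : Measurable r) {π π' : Policy X A} {j : ℕ}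
    (h : ∀ x, j + 1 ≤ (M.layer x : ℕ) → π.1 x = π'.1 x) {k : ℕ} {x : X}
    (hx : (M.layer x : ℕ) = j) (hk : j + 1 + k ≤ H) (a : A) :
    M.returnKernel r π k (x, a) = M.returnKernel r π' k (x, a) := by
  rw [returnKernel, returnKernel, Kernel.map_apply _ (measurable_return hr k),
    Kernel.map_apply _ (measurable_return hr k), Kernel.prod_apply, Kernel.prod_apply,
    Kernel.comp_apply, Kernel.comp_apply, M.comp_rollout_congr h hx hk a]

theorem qValue_congr (hr : Measurable r) (h1 : ∀ p, |r p| ≤ 1) {π π' : Policy X A} {j : ℕ}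
    (h : ∀ x, j + 1 ≤ (M.layer x : ℕ) → π.1 x = π'.1 x) {k : ℕ} {x : X}
    (hx : (M.layer x : ℕ) = j) (hk : j + 1 + k ≤ H) (a : A) :
    M.qValue r π k (x, a) = M.qValue r π' k (x, a) := by
  rw [← M.integral_returnKernel hr h1, ← M.integral_returnKernel hr h1,
    M.returnKernel_congr hr h hx hk a]

/-- The rewards `r_h`, gathered in a single function of the state-action pair: the state determines
its layer. -/
def layerReward (M : LowRankMDP X A d H) (r : Fin H → X → A → ℝ) (p : X × A) : ℝ :=
  r (M.layer p.1) p.1 p.2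

theorem measurable_layerReward [Countable A] [MeasurableSingletonClass A]
    {r : Fin H → X → A → ℝ} (hr : ∀ h a, Measurable fun x => r h x a) :
    Measurable (M.layerReward r) := by
  refine measurable_from_prod_countable_left fun a => ?_
  exact (measurable_from_prod_countable_right (f := fun p : Fin H × X => r p.1 p.2 a)
    (fun h => hr h a)).comp (M.layer_measurable.prodMk measurable_id)

theorem value_eq_integral_rolloutValue [Countable A] [MeasurableSingletonClass A]
    {r : Fin H → X → A → ℝ} (hr : ∀ h a, Measurable fun x => r h x a)
    (h1 : ∀ p, |M.layerReward r p| ≤ 1) (π : Policy X A) :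
    M.value r π = ∫ x, M.rolloutValue (M.layerReward r) π H x ∂M.ρ := by
  have hlayer : M.value r π = ∫ τ, ∑ h, M.layerReward r (τ h) ∂(M.trajLaw π) := by
    refine integral_congr_ae ?_
    filter_upwards [M.ae_forall_layer π] with τ hτ
    simp only [layerReward, hτ]
  rw [hlayer, trajLaw, integral_measure_comp]
  · rfl
  · exact integrable_sum_reward (M.measurable_layerReward hr) h1 _

end Value

/-! ### The law of an observation -/

section Sampling

variable {X A : Type*} [MeasurableSpace X] [MeasurableSpace A] {d H : ℕ}
variable (M : LowRankMDP X A d H)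

theorem measurable_stateAt {Z : Type*} [MeasurableSpace Z] {π : Z → Policy X A}
    (hπ : IsMeasurableFamily π) (t : Fin H) : Measurable fun z => M.stateAt (π z) t := by
  simp_rw [← stateLaw_eq_stateAt, stateLaw]
  exact (Measure.measurable_map _ (by fun_prop)).comp (hπ.trajLaw M)

/-- The law of the state at layer `t` when a policy drawn from `P` is played. -/
def mixState (P : PolicyDist X A) (t : Fin H) : Measure X :=
  P.law.bind fun i => M.stateAt (P.policy i) t

instance (P : PolicyDist X A) (t : Fin H) : IsProbabilityMeasure (M.mixState P t) :=
  isProbabilityMeasure_bind (M.measurable_stateAt P.isMeasurableFamily_policy t).aemeasurable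
    (.of_forall fun _ => inferInstance)

theorem mixState_layer (P : PolicyDist X A) (t : Fin H) :
    ∀ᵐ x ∂(M.mixState P t), M.layer x = t := by
  have hs : MeasurableSet {x | M.layer x = t}ᶜ := (M.measurableSet_layer t).compl
  rw [ae_iff, ← Set.compl_ofPred, mixState, Measure.bind_apply hs
    (M.measurable_stateAt P.isMeasurableFamily_policy t).aemeasurable]
  exact lintegral_eq_zero_of_ae_eq_zero (.of_forall fun i => M.stateAt_layer (P.policy i) t)

theorem measurable_observation [Countable A] [MeasurableSingletonClass A]
    {r : Fin H → X → A → ℝ} (hr : ∀ h a, Measurable fun x => r h x a) (t : Fin H) :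
    Measurable fun τ : Fin H → X × A =>
      ((τ t).1, (τ t).2, ∑ l with t ≤ l, r l (τ l).1 (τ l).2) := by
  have hr' : ∀ l, Measurable fun p : X × A => r l p.1 p.2 := fun l =>
    measurable_from_prod_countable_left fun a => hr l a
  have : Measurable fun τ : Fin H → X × A => ∑ l with t ≤ l, r l (τ l).1 (τ l).2 :=
    Finset.measurable_sum _ fun l _ => (hr' l).comp (measurable_pi_apply l)
  fun_prop

theorem map_return_trajLaw [Countable A] [MeasurableSingletonClass A] {r : Fin H → X → A → ℝ}
    (hr : ∀ h a, Measurable fun x => r h x a) (π : Policy X A) (t : Fin H) {k : ℕ}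
    (hk : (t : ℕ) + (k + 1) = H) :
    (M.trajLaw π).map (fun τ => (τ t, ∑ l with t ≤ l, r l (τ l).1 (τ l).2)) =
      ((M.stateAt π t) ⊗ₘ π.1) ⊗ₘ M.returnKernel (M.layerReward r) π k := by
  have hr' := M.measurable_layerReward hr
  have := M.isMarkovKernel_returnKernel hr' π k
  have hpair : Measurable fun σ : Fin (k + 1) → X × A => (σ 0, ∑ i, M.layerReward r (σ i)) := by
    fun_prop
  have hsuffix : Measurable fun (τ : Fin H → X × A) (i : Fin (k + 1)) =>
      τ ⟨t + i, by omega⟩ := by fun_prop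
  calc _ = (M.trajLaw π).map
          ((fun σ : Fin (k + 1) → X × A => (σ 0, ∑ i, M.layerReward r (σ i))) ∘
            fun τ i => τ ⟨t + i, by omega⟩) := by
        refine Measure.map_congr ?_
        filter_upwards [M.ae_forall_layer π] with τ hτ
        simp only [sum_filter_le_eq_sum_fin _ t hk, layerReward, hτ, Function.comp_apply,
          Fin.val_zero, add_zero]
    _ = (Kernel.id ×ₖ M.returnKernel (M.layerReward r) π k) ∘ₘ
          ((Kernel.id ×ₖ π.1) ∘ₘ M.stateAt π t) := by
        rw [← Measure.map_map hpair hsuffix, M.map_suffix_trajLaw π hk,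
          Measure.map_comp _ _ hpair, M.map_return_rollout hr', Measure.comp_assoc]
    _ = _ := by rw [← Measure.compProd_eq_comp_prod, ← Measure.compProd_eq_comp_prod]

variable [Nonempty A] [Fintype A] [MeasurableSingletonClass A]

theorem map_return_trajLaw_rollIn {r : Fin H → X → A → ℝ}
    (hr : ∀ h a, Measurable fun x => r h x a) (π π' : Policy X A) (t : Fin H) {k : ℕ}
    (hk : (t : ℕ) + (k + 1) = H) :
    (M.trajLaw (concat M π t (concat M unifPolicy (t + 1) π'))).map
        (fun τ => (τ t, ∑ l with t ≤ l, r l (τ l).1 (τ l).2)) =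
      ((M.stateAt π t).prod (uniformOn Set.univ)) ⊗ₘ M.returnKernel (M.layerReward r) π' k := by
  have hr' := M.measurable_layerReward hr
  have hlayer := M.stateAt_layer π t
  rw [M.map_return_trajLaw hr _ t hk,
    M.stateAt_congr t.2 (π' := π) fun x hx => concat_apply_of_lt M _ _ hx,
    ← Measure.compProd_const]
  have hroll : (concat M π t (concat M unifPolicy (t + 1) π')).1 =ᵐ[M.stateAt π t]
      Kernel.const X (uniformOn Set.univ) := by
    filter_upwards [hlayer] with x hx
    rw [concat_apply_of_le M _ _ (by rw [hx]), concat_apply_of_lt M _ _ (by rw [hx]; omega)]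
    rfl
  have := M.isMarkovKernel_returnKernel hr' π' k
  have := M.isMarkovKernel_returnKernel hr'
    (concat M π t (concat M unifPolicy (t + 1) π')) k
  rw [Measure.compProd_congr hroll]
  refine Measure.compProd_congr ?_
  rw [Measure.compProd_const]
  filter_upwards [Measure.quasiMeasurePreserving_fst.ae hlayer] with p hp
  refine M.returnKernel_congr (j := t) hr' (fun x hx => ?_) (by rw [hp]) (by omega) p.2
  rw [concat_apply_of_le M _ _ (by omega), concat_apply_of_le M _ _ hx]

theorem sampleLaw_eq_map_compProd {r : Fin H → X → A → ℝ}
    (hr : ∀ h a, Measurable fun x => r h x a) (P : PolicyDist X A) (t : Fin H) {k : ℕ}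
    (hk : (t : ℕ) + (k + 1) = H) (π' : Policy X A) :
    sampleLaw M r P t π' =
      (((M.mixState P t).prod (uniformOn Set.univ)) ⊗ₘ
        M.returnKernel (M.layerReward r) π' k).map fun q => (q.1.1, q.1.2, q.2) := by
  have hr' := M.measurable_layerReward hr
  have := M.isMarkovKernel_returnKernel hr' π' k
  have hassoc : Measurable fun q : (X × A) × ℝ => (q.1.1, q.1.2, q.2) := by fun_prop
  have hpair : Measurable fun τ : Fin H → X × A =>
      (τ t, ∑ l with t ≤ l, r l (τ l).1 (τ l).2) :=
    (measurable_pi_apply t).prodMk (measurable_observation hr t).snd.snd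
  -- The law of an observation is linear in the law of the state, so that the average over `P`
  -- can be taken inside.
  let K : Kernel X (X × A × ℝ) :=
    ((Kernel.id ×ₖ M.returnKernel (M.layerReward r) π' k) ∘ₖ
      (Kernel.id ×ₖ Kernel.const X (uniformOn Set.univ))).map fun q => (q.1.1, q.1.2, q.2)
  have hK : ∀ m : Measure X, [SFinite m] → K ∘ₘ m = ((m.prod (uniformOn Set.univ)) ⊗ₘ
      M.returnKernel (M.layerReward r) π' k).map fun q => (q.1.1, q.1.2, q.2) := fun m _ => by
    rw [← Measure.compProd_const, Measure.compProd_eq_comp_prod, Measure.compProd_eq_comp_prod,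
      Measure.comp_assoc, Measure.map_comp _ _ hassoc]
  rw [← hK, mixState, Measure.bind_bind
    (M.measurable_stateAt P.isMeasurableFamily_policy t).aemeasurable K.aemeasurable, sampleLaw]
  simp_rw [hK, ← M.map_return_trajLaw_rollIn hr _ π' t hk, Measure.map_map hassoc hpair]
  rfl

theorem isProbabilityMeasure_sampleLaw {r : Fin H → X → A → ℝ}
    (hr : ∀ h a, Measurable fun x => r h x a) (P : PolicyDist X A) (t : Fin H)
    (π' : Policy X A) : IsProbabilityMeasure (sampleLaw M r P t π') := by
  have := M.isMarkovKernel_returnKernel (M.measurable_layerReward hr) π' (H - t - 1)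
  rw [M.sampleLaw_eq_map_compProd hr P t (k := H - t - 1) (by omega)]
  exact Measure.isProbabilityMeasure_map (by fun_prop)

theorem measurable_sampleLaw {Z : Type*} [MeasurableSpace Z] {r : Fin H → X → A → ℝ}
    (hr : ∀ h a, Measurable fun x => r h x a) (P : PolicyDist X A) (t : Fin H)
    {π' : Z → Policy X A} (hπ' : IsMeasurableFamily π') :
    Measurable fun z => sampleLaw M r P t (π' z) := by
  have hfamily : IsMeasurableFamily fun p : Z × P.Idx =>
      concat M (P.policy p.2) t (concat M unifPolicy (t + 1) (π' p.1)) :=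
    (P.isMeasurableFamily_policy.comp measurable_snd).concat M
      ((isMeasurableFamily_const _).concat M (hπ'.comp measurable_fst) _) _
  have hlaw := (Measure.measurable_map _ (measurable_observation hr t)).comp (hfamily.trajLaw M)
  refine Measure.measurable_of_measurable_coe _ fun s hs => ?_
  have happly : ∀ z, sampleLaw M r P t (π' z) s = ∫⁻ i, (M.trajLaw (concat M (P.policy i) t
      (concat M unifPolicy (t + 1) (π' z)))).map
        (fun τ => ((τ t).1, (τ t).2, ∑ l with t ≤ l, r l (τ l).1 (τ l).2)) s ∂P.law := fun z =>
    Measure.bind_apply (m := P.law) hs (hlaw.comp measurable_prodMk_left).aemeasurable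
  simp_rw [happly]
  exact ((Measure.measurable_coe hs).comp hlaw).lintegral_prod_right'

theorem map_stateAction_sampleLaw {r : Fin H → X → A → ℝ}
    (hr : ∀ h a, Measurable fun x => r h x a) (P : PolicyDist X A) (t : Fin H) (π' : Policy X A) :
    (sampleLaw M r P t π').map (fun z => (z.1, z.2.1)) =
      (M.mixState P t).prod (uniformOn Set.univ) := by
  have := M.isMarkovKernel_returnKernel (M.measurable_layerReward hr) π' (H - t - 1)
  rw [M.sampleLaw_eq_map_compProd hr P t (k := H - t - 1) (by omega),
    Measure.map_map (by fun_prop) (by fun_prop)]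
  exact Measure.fst_compProd _ _

theorem sampleLaw_layer {r : Fin H → X → A → ℝ}
    (hr : ∀ h a, Measurable fun x => r h x a) (P : PolicyDist X A) (t : Fin H) (π' : Policy X A) :
    ∀ᵐ z ∂(sampleLaw M r P t π'), M.layer z.1 = t := by
  have hmap : ∀ᵐ p ∂((sampleLaw M r P t π').map fun z => (z.1, z.2.1)), M.layer p.1 = t := by
    rw [M.map_stateAction_sampleLaw hr]
    exact Measure.quasiMeasurePreserving_fst.ae (M.mixState_layer P t)
  exact ae_of_ae_map (Measurable.aemeasurable (by fun_prop)) hmap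

theorem sampleLaw_abs_le {r : Fin H → X → A → ℝ} (hr : ∀ h a, Measurable fun x => r h x a)
    (h1 : ∀ p, |M.layerReward r p| ≤ 1) (P : PolicyDist X A) (t : Fin H) {k : ℕ}
    (hk : (t : ℕ) + (k + 1) = H) (π' : Policy X A) :
    ∀ᵐ z ∂(sampleLaw M r P t π'), |z.2.2| ≤ (k : ℝ) + 1 := by
  have hr' := M.measurable_layerReward hr
  have := M.isMarkovKernel_returnKernel hr' π' k
  rw [M.sampleLaw_eq_map_compProd hr P t hk π', ae_map_iff (Measurable.aemeasurable (by fun_prop))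
    (measurableSet_le (by fun_prop) (by fun_prop))]
  refine Measure.ae_compProd_of_ae_ae (measurableSet_le (by fun_prop) (by fun_prop)) ?_
  exact .of_forall fun p => M.abs_returnKernel_le hr' h1 π' k p

theorem integral_mul_residual_sampleLaw {r : Fin H → X → A → ℝ}
    (hr : ∀ h a, Measurable fun x => r h x a) (h1 : ∀ p, |M.layerReward r p| ≤ 1)
    (P : PolicyDist X A) (t : Fin H) {k : ℕ} (hk : (t : ℕ) + (k + 1) = H) (π' : Policy X A)
    {f : X × A → ℝ} (hf : Measurable f) {C : ℝ} (hC : ∀ p, |f p| ≤ C) :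
    ∫ z, f (z.1, z.2.1) * (z.2.2 - M.qValue (M.layerReward r) π' k (z.1, z.2.1))
      ∂(sampleLaw M r P t π') = 0 := by
  have hr' := M.measurable_layerReward hr
  have := M.isMarkovKernel_returnKernel hr' π' k
  have mQ := M.measurable_qValue hr' π' k
  have hreturn := M.abs_returnKernel_le hr' h1 π' k
  rw [M.sampleLaw_eq_map_compProd hr P t hk π', integral_map (by fun_prop)
    (Measurable.aestronglyMeasurable (by fun_prop))]
  rw [Measure.integral_compProd]
  · refine integral_eq_zero_of_ae (.of_forall fun p => ?_)
    have hs : Integrable (fun s : ℝ => s) (M.returnKernel (M.layerReward r) π' k p) :=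
      .of_bound measurable_id.aestronglyMeasurable _ (hreturn p)
    simp only [Pi.zero_apply, integral_const_mul]
    rw [integral_sub hs (integrable_const _), M.integral_returnKernel hr' h1]
    simp
  · refine .of_bound (Measurable.aestronglyMeasurable (by fun_prop)) (C * ((k + 1) + (k + 1))) ?_
    refine Measure.ae_compProd_of_ae_ae (measurableSet_le (by fun_prop) measurable_const) ?_
    refine .of_forall fun p => ?_
    filter_upwards [hreturn p] with s hs
    rw [Real.norm_eq_abs, abs_mul]
    exact mul_le_mul (hC p) ((abs_sub _ _).trans (add_le_add hs (M.abs_qValue_le h1 π' k p)))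
      (abs_nonneg _) ((abs_nonneg _).trans (hC p))

end Sampling

section Linear

variable {X A : Type*} [MeasurableSpace X] [MeasurableSpace A] {d H : ℕ}
variable (M : LowRankMDP X A d H)

theorem measurable_linearReward (θ : Fin H → EuclideanSpace ℝ (Fin d)) (h : Fin H) (a : A) :
    Measurable fun x => linearReward M θ h x a :=
  measurable_const.inner (M.φ_measurable h a)

theorem abs_layerReward_linearReward_le {θ : Fin H → EuclideanSpace ℝ (Fin d)}
    (hθ : ∀ h, ‖θ h‖ ≤ 1) (p : X × A) : |M.layerReward (linearReward M θ) p| ≤ 1 :=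
  abs_inner_le_of_norm_le (hθ _) (M.φ_norm _ _ _ rfl)

theorem integral_T_eq_inner {h h' : Fin H} (hh : (h' : ℕ) = h + 1) {f : X → ℝ}
    (hf : Measurable f) {C : ℝ} (hC : ∀ x, |f x| ≤ C) {x : X} (hx : M.layer x = h) (a : A) :
    ∫ y, f y ∂(M.T (x, a)) =
      inner ℝ (M.φ h x a) (∫ y in {y | M.layer y = h'}, f y • M.μ h' y ∂M.ν) := by
  have hT : ∀ᵐ y ∂(M.T (x, a)), y ∈ {y | M.layer y = h'} := by
    filter_upwards [M.T_layer x a (by rw [hx]; omega)] with y hy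
    exact Fin.ext (by rw [hy, hx, hh])
  have hdensity : Measurable fun y => ENNReal.ofReal (inner ℝ (M.μ h' y) (M.φ h x a)) :=
    ENNReal.measurable_ofReal.comp ((M.μ_measurable h').inner measurable_const)
  have hint : IntegrableOn (fun y => f y • M.μ h' y) {y | M.layer y = h'} M.ν :=
    (M.μ_integrable h').bdd_smul C hf.aestronglyMeasurable (.of_forall hC)
  rw [← Measure.restrict_eq_self_of_ae_mem hT, M.T_eq h h' hh x hx a,
    restrict_withDensity (M.measurableSet_layer h'),
    integral_withDensity_eq_integral_toReal_smul hdensity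
      (.of_forall fun y => ENNReal.ofReal_lt_top),
    ← integral_inner hint]
  refine integral_congr_ae (.of_forall fun y => ?_)
  simp only [ENNReal.toReal_ofReal (M.density_nonneg h h' hh x hx a y), inner_smul_right,
    smul_eq_mul]
  rw [real_inner_comm, mul_comm]

theorem exists_qValue_eq_inner [Countable A] [MeasurableSingletonClass A] (hd : 1 ≤ d)
    {θ : Fin H → EuclideanSpace ℝ (Fin d)} (hθ : ∀ h, ‖θ h‖ ≤ 1) (π : Policy X A) (t : Fin H)
    {k : ℕ} (hk : (t : ℕ) + (k + 1) = H) :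
    ∃ w : EuclideanSpace ℝ (Fin d), ‖w‖ ≤ 2 * (H : ℝ) * √(d : ℝ) ∧ ∀ x, M.layer x = t →
      ∀ a, M.qValue (M.layerReward (linearReward M θ)) π k (x, a) = inner ℝ (M.φ t x a) w := by
  have hreward : ∀ x, M.layer x = t → ∀ a,
      M.layerReward (linearReward M θ) (x, a) = inner ℝ (M.φ t x a) (θ t) := fun x hx a => by
    simp only [layerReward, linearReward, hx, real_inner_comm]
  have hsd : 1 ≤ √(d : ℝ) := Real.one_le_sqrt.2 (by exact_mod_cast hd)
  have hH : (k : ℝ) + 1 ≤ H := by exact_mod_cast (by omega : k + 1 ≤ H)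
  rcases Nat.eq_zero_or_pos k with rfl | hk0
  · refine ⟨θ t, (hθ t).trans ?_, fun x hx a => ?_⟩
    · simp only [CharP.cast_eq_zero] at hH
      nlinarith
    · simp only [qValue, rolloutValue_zero, integral_zero, add_zero, hreward x hx a]
  · let t' : Fin H := ⟨t + 1, by omega⟩
    have hr := M.measurable_layerReward (measurable_linearReward M θ)
    have hV := M.measurable_rolloutValue hr π k
    have hVk := M.abs_rolloutValue_le (M.abs_layerReward_linearReward_le hθ) π k
    refine ⟨θ t + ∫ y in {y | M.layer y = t'},
      M.rolloutValue (M.layerReward (linearReward M θ)) π k y • M.μ t' y ∂M.ν, ?_, fun x hx a => ?_⟩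
    · have hnorm := norm_integral_smul_le_two_mul (M.μ_integrable t') (M.μ_normalized t') hV
        (Nat.cast_pos.2 hk0) hVk
      refine (norm_add_le _ _).trans ?_
      nlinarith [hθ t]
    · rw [qValue, M.integral_T_eq_inner (h := t) (h' := t') rfl hV hVk hx a, inner_add_right,
        hreward x hx a]

end Linear

/-! ### Occupancies and covers -/

section Coverage

variable {X A : Type*} [MeasurableSpace X] [MeasurableSpace A] {d H : ℕ}
variable (M : LowRankMDP X A d H)

/-- The mean `𝔼^π[φ⋆_g(x_g, a_g)]` of the features at layer `g`, against which `μ⋆_{g+1}` is paired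
in the occupancy. -/
def meanFeature (π : Policy X A) (g : Fin H) : EuclideanSpace ℝ (Fin d) :=
  ∫ τ, M.φ g (τ g).1 (τ g).2 ∂(M.trajLaw π)

theorem ae_norm_feature_le (π : Policy X A) (g : Fin H) :
    ∀ᵐ τ ∂(M.trajLaw π), ‖M.φ g (τ g).1 (τ g).2‖ ≤ 1 := by
  filter_upwards [M.ae_layer π g g.2] with τ hτ
  exact M.φ_norm g _ _ hτ

theorem norm_meanFeature_le (π : Policy X A) (g : Fin H) : ‖M.meanFeature π g‖ ≤ 1 := by
  simpa [meanFeature] using norm_integral_le_of_norm_le_const (M.ae_norm_feature_le π g)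

variable {g h : Fin H}

theorem occupancy_eq_inner (hgh : (h : ℕ) = g + 1) (π : Policy X A) (x : X) :
    M.occupancy π h x = inner ℝ (M.μ h x) (M.meanFeature π g) := by
  obtain rfl : g = ⟨(h : ℕ) - 1, lt_of_le_of_lt (Nat.sub_le _ _) h.2⟩ := by ext; simp; omega
  rw [occupancy, if_neg (by omega)]
  rfl

theorem occupancy_le_iSup (hgh : (h : ℕ) = g + 1) (π : Policy X A) (x : X) :
    M.occupancy π h x ≤ ⨆ π' : Policy X A, M.occupancy π' h x := by
  refine le_ciSup (f := fun π' : Policy X A => M.occupancy π' h x) ⟨‖M.μ h x‖, ?_⟩ π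
  rintro _ ⟨π', rfl⟩
  simp only [M.occupancy_eq_inner hgh]
  exact (real_inner_le_norm _ _).trans
    (mul_le_of_le_one_right (norm_nonneg _) (M.norm_meanFeature_le π' g))

theorem measurable_occupancy (hgh : (h : ℕ) = g + 1) (π : Policy X A) :
    Measurable (M.occupancy π h) := by
  rw [funext (M.occupancy_eq_inner hgh π)]
  exact (M.μ_measurable h).inner measurable_const

/-- The density `𝔼_{π ∼ P}[d^π]` of `mixState`. -/
def mixOccupancy (P : PolicyDist X A) (h : Fin H) (x : X) : ℝ :=
  ∫ i, M.occupancy (P.policy i) h x ∂P.law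

theorem mixState_of_val_eq_zero (P : PolicyDist X A) {t : Fin H} (ht : (t : ℕ) = 0) :
    M.mixState P t = M.ρ := by
  have hρ : ∀ i, M.stateAt (P.policy i) t = M.ρ := fun i => by
    rw [← M.stateLaw_eq_stateAt, M.stateLaw_zero _ t ht]
  simp_rw [mixState, hρ]
  rw [Measure.bind_const, measure_univ, one_smul]

variable [Countable A] [MeasurableSingletonClass A]

theorem measurable_feature (g : Fin H) :
    Measurable fun τ : Fin H → X × A => M.φ g (τ g).1 (τ g).2 :=
  (measurable_from_prod_countable_left (f := fun p : X × A => M.φ g p.1 p.2)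
    (M.φ_measurable g)).comp (measurable_pi_apply g)

theorem stronglyMeasurable_meanFeature (P : PolicyDist X A) (g : Fin H) :
    StronglyMeasurable fun i => M.meanFeature (P.policy i) g := by
  let R : Kernel P.Idx (Fin H → X × A) := ⟨_, P.isMeasurableFamily_policy.trajLaw M⟩
  exact StronglyMeasurable.integral_kernel (κ := R) (M.measurable_feature g).stronglyMeasurable

theorem integrable_meanFeature (P : PolicyDist X A) (g : Fin H) :
    Integrable (fun i => M.meanFeature (P.policy i) g) P.law :=
  .of_bound (M.stronglyMeasurable_meanFeature P g).aestronglyMeasurable 1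
    (.of_forall fun _ => M.norm_meanFeature_le _ g)

theorem occupancy_nonneg (hgh : (h : ℕ) = g + 1) (π : Policy X A) (x : X) :
    0 ≤ M.occupancy π h x := by
  rw [M.occupancy_eq_inner hgh, meanFeature, ← integral_inner]
  · refine integral_nonneg_of_ae ?_
    filter_upwards [M.ae_layer π g g.2] with τ hτ
    exact M.density_nonneg g h hgh _ hτ _ _
  · exact .of_bound (M.measurable_feature g).aestronglyMeasurable 1 (M.ae_norm_feature_le π g)

theorem integrable_occupancy_policy (hgh : (h : ℕ) = g + 1) (P : PolicyDist X A) (x : X) :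
    Integrable (fun i => M.occupancy (P.policy i) h x) P.law := by
  simp_rw [M.occupancy_eq_inner hgh]
  exact (M.integrable_meanFeature P g).const_inner _

theorem measurable_mixOccupancy (hgh : (h : ℕ) = g + 1) (P : PolicyDist X A) :
    Measurable (M.mixOccupancy P h) := by
  have heq : M.mixOccupancy P h =
      fun x => inner ℝ (M.μ h x) (∫ i, M.meanFeature (P.policy i) g ∂P.law) := by
    funext x
    simp_rw [mixOccupancy, M.occupancy_eq_inner hgh]
    exact integral_inner (M.integrable_meanFeature P g) _
  rw [heq]
  exact (M.μ_measurable h).inner measurable_const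

end Coverage

section Density

variable {X A : Type*} [MeasurableSpace X] [MeasurableSpace A] {d H : ℕ}
variable [Finite A] [MeasurableSingletonClass A] (M : LowRankMDP X A d H) {g h : Fin H}

theorem stateAt_eq_withDensity (hgh : (h : ℕ) = g + 1) (π : Policy X A) :
    M.stateAt π h = M.ν.withDensity fun x => ENNReal.ofReal (M.occupancy π h x) := by
  have := Fintype.ofFinite A
  rw [← M.stateLaw_eq_stateAt, M.stateLaw_eq_withDensity π h (by omega)]

theorem mixState_eq_withDensity (hgh : (h : ℕ) = g + 1) (P : PolicyDist X A) :
    M.mixState P h = M.ν.withDensity fun x => ENNReal.ofReal (M.mixOccupancy P h x) := by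
  have hocc : Measurable fun p : P.Idx × X => M.occupancy (P.policy p.1) h p.2 := by
    simp_rw [M.occupancy_eq_inner hgh]
    exact ((M.μ_measurable h).comp measurable_snd).inner
      ((M.stronglyMeasurable_meanFeature P g).measurable.comp measurable_fst)
  ext s hs
  calc M.mixState P h s = ∫⁻ i, M.stateAt (P.policy i) h s ∂P.law :=
        Measure.bind_apply hs (M.measurable_stateAt P.isMeasurableFamily_policy h).aemeasurable
    _ = ∫⁻ i, ∫⁻ x in s, ENNReal.ofReal (M.occupancy (P.policy i) h x) ∂M.ν ∂P.law := by
        simp_rw [M.stateAt_eq_withDensity hgh, withDensity_apply _ hs]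
    _ = ∫⁻ x in s, ∫⁻ i, ENNReal.ofReal (M.occupancy (P.policy i) h x) ∂P.law ∂M.ν :=
        lintegral_lintegral_swap hocc.ennreal_ofReal.aemeasurable
    _ = ∫⁻ x in s, ENNReal.ofReal (M.mixOccupancy P h x) ∂M.ν := by
        refine lintegral_congr fun x => ?_
        rw [mixOccupancy, ofReal_integral_eq_lintegral_ofReal
          (M.integrable_occupancy_policy hgh P x) (.of_forall fun i => M.occupancy_nonneg hgh _ x)]
    _ = _ := (withDensity_apply _ hs).symm

theorem stateAt_real_le_of_occupancy_le (hgh : (h : ℕ) = g + 1) (π : Policy X A) {ε : ℝ}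
    (hε : 0 ≤ ε) {s : Set X} (hs : MeasurableSet s)
    (hocc : ∀ x ∈ s, M.layer x = h → M.occupancy π h x ≤ ε * ‖M.μ h x‖) :
    (M.stateAt π h).real s ≤ ε * (2 * (d * √(d : ℝ))) := by
  have hlayer := M.measurableSet_layer h
  have hμ := M.μ_integrable h
  refine ENNReal.toReal_le_of_le_ofReal (by positivity) ?_
  calc M.stateAt π h s ≤ M.stateAt π h (s ∩ {x | M.layer x = h}) := by
        refine measure_mono_ae ?_
        filter_upwards [M.stateAt_layer π h] with x hx hxs
        exact ⟨hxs, hx⟩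
    _ = ∫⁻ x in s ∩ {x | M.layer x = h}, ENNReal.ofReal (M.occupancy π h x) ∂M.ν := by
        rw [M.stateAt_eq_withDensity hgh, withDensity_apply _ (hs.inter hlayer)]
    _ ≤ ∫⁻ x in s ∩ {x | M.layer x = h}, ENNReal.ofReal (ε * ‖M.μ h x‖) ∂M.ν :=
        setLIntegral_mono ((M.μ_measurable h).norm.const_mul ε).ennreal_ofReal
          fun x hx => ENNReal.ofReal_le_ofReal (hocc x hx.1 hx.2)
    _ ≤ ∫⁻ x in {x | M.layer x = h}, ENNReal.ofReal (ε * ‖M.μ h x‖) ∂M.ν :=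
        lintegral_mono_set Set.inter_subset_right
    _ = ENNReal.ofReal (ε * ∫ x in {x | M.layer x = h}, ‖M.μ h x‖ ∂M.ν) := by
        rw [← integral_const_mul, ofReal_integral_eq_lintegral_ofReal (hμ.norm.const_mul ε)
          (.of_forall fun x => by positivity)]
    _ ≤ ENNReal.ofReal (ε * (2 * (d * √(d : ℝ)))) := by
        gcongr
        simpa using integral_norm_le_two_mul_card_mul hμ (M.μ_measurable h) (M.μ_normalized h)

theorem restrict_stateAt_le_of_occupancy_le (hgh : (h : ℕ) = g + 1) (P : PolicyDist X A)
    (π : Policy X A) {c : ℝ} (hc : 0 ≤ c) {s : Set X} (hs : MeasurableSet s)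
    (hocc : ∀ x ∈ s, M.occupancy π h x ≤ c * M.mixOccupancy P h x) :
    (M.stateAt π h).restrict s ≤ ENNReal.ofReal c • M.mixState P h := by
  have hmix := (M.measurable_mixOccupancy hgh P).ennreal_ofReal
  rw [M.stateAt_eq_withDensity hgh, M.mixState_eq_withDensity hgh, restrict_withDensity hs,
    ← withDensity_smul _ hmix]
  refine (withDensity_mono ?_).trans
    ((restrict_withDensity hs _).symm.trans_le Measure.restrict_le_self)
  filter_upwards [ae_restrict_mem hs] with x hx
  rw [Pi.smul_apply, smul_eq_mul, ← ENNReal.ofReal_mul hc]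
  exact ENNReal.ofReal_le_ofReal (hocc x hx)

end Density

end LowRankMDP

section PolicyCover

variable {X A : Type*} [MeasurableSpace X] [MeasurableSpace A] {d H : ℕ} {M : LowRankMDP X A d H}
  {P : PolicyDist X A} {α ε : ℝ} {g h : Fin H}

theorem IsRandomizedPolicyCover.occupancy_le_of_lt
    (hP : IsRandomizedPolicyCover M P α ε h) (hα : 0 < α) (hgh : (h : ℕ) = g + 1)
    (π : Policy X A) {x : X} (hx : M.layer x = h)
    (hlt : α⁻¹ * M.mixOccupancy P h x < M.occupancy π h x) :
    M.occupancy π h x ≤ ε * ‖M.μ h x‖ := by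
  by_contra! hbig
  have hsup := M.occupancy_le_iSup hgh π x
  have hcover := hP x hx (hbig.le.trans hsup)
  refine hlt.not_ge ((le_inv_mul_iff₀ hα).2 ?_)
  exact (mul_le_mul_of_nonneg_left hsup hα.le).trans hcover

theorem IsRandomizedPolicyCover.exists_restrict_stateAt_le [Finite A] [MeasurableSingletonClass A]
    (hP : IsRandomizedPolicyCover M P α ε h) (hα : α ∈ Set.Ioo 0 1) (hε : 0 ≤ ε)
    (π : Policy X A) :
    ∃ s, MeasurableSet s ∧ (M.stateAt π h).restrict s ≤ ENNReal.ofReal α⁻¹ • M.mixState P h ∧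
      (M.stateAt π h).real sᶜ ≤ if (h : ℕ) = 0 then 0 else ε * (2 * (d * √(d : ℝ))) := by
  by_cases h0 : (h : ℕ) = 0
  · refine ⟨Set.univ, .univ, ?_, by simp [h0]⟩
    rw [Measure.restrict_univ, M.mixState_of_val_eq_zero P h0, ← M.stateLaw_eq_stateAt,
      M.stateLaw_zero π h h0]
    refine Measure.le_iff.2 fun s _ => le_mul_of_one_le_left zero_le ?_
    exact ENNReal.one_le_ofReal.2 ((one_le_inv₀ hα.1).2 hα.2.le)
  · have hgh : (h : ℕ) = (⟨h - 1, by omega⟩ : Fin H) + 1 := by simp only; omega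
    have hs : MeasurableSet {x | M.occupancy π h x ≤ α⁻¹ * M.mixOccupancy P h x} :=
      measurableSet_le (M.measurable_occupancy hgh π)
        ((M.measurable_mixOccupancy hgh P).const_mul _)
    refine ⟨_, hs, M.restrict_stateAt_le_of_occupancy_le hgh P π (inv_nonneg.2 hα.1.le) hs
      fun x hx => hx, ?_⟩
    rw [if_neg h0]
    exact M.stateAt_real_le_of_occupancy_le hgh π hε hs.compl fun x hxs hx =>
      hP.occupancy_le_of_lt hα.1 hgh π hx (not_le.1 hxs)

end PolicyCover

/-! ### Performance difference -/

namespace LowRankMDP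

section Performance

variable {X A : Type*} [MeasurableSpace X] [MeasurableSpace A] {d H : ℕ}
variable (M : LowRankMDP X A d H) {r : X × A → ℝ}

theorem integral_rolloutValue_succ (hr : Measurable r) (h1 : ∀ p, |r p| ≤ 1) (π : Policy X A)
    (k : ℕ) (s : Measure X) [IsProbabilityMeasure s] :
    ∫ x, M.rolloutValue r π (k + 1) x ∂s = ∫ p, M.qValue r π k p ∂(s ⊗ₘ π.1) := by
  rw [Measure.integral_compProd (.of_bound (M.measurable_qValue hr π k).aestronglyMeasurable (k + 1)
    (.of_forall (M.abs_qValue_le h1 π k)))]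
  simp_rw [M.rolloutValue_succ hr h1 π k]

theorem stateAt_succ_eq_comp_compProd (π : Policy X A) (t : ℕ) :
    M.stateAt π (t + 1) = M.T ∘ₘ (M.stateAt π t ⊗ₘ π.1) := by
  rw [stateAt, stepKernel, Measure.compProd_eq_comp_prod, Measure.comp_assoc]

theorem integral_qValue_stateAt (hr : Measurable r) (h1 : ∀ p, |r p| ≤ 1) (π π' : Policy X A)
    (k t : ℕ) :
    ∫ p, M.qValue r π' k p ∂(M.stateAt π t ⊗ₘ π.1) =
      ∫ p, r p ∂(M.stateAt π t ⊗ₘ π.1) + ∫ y, M.rolloutValue r π' k y ∂(M.stateAt π (t + 1)) := by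
  have hV := M.integrable_rolloutValue hr h1 π' k
  rw [M.stateAt_succ_eq_comp_compProd, integral_measure_comp (hV _), ← integral_add]
  · rfl
  · exact .of_bound hr.aestronglyMeasurable 1 (.of_forall h1)
  · exact (hV _).integral_comp

theorem integral_rolloutValue_le_add_sum (hr : Measurable r) (h1 : ∀ p, |r p| ≤ 1)
    (π π' : Policy X A) {b : ℕ → ℝ}
    (hb : ∀ t k, t + (k + 1) = H → ∫ p, M.qValue r π' k p ∂(M.stateAt π t ⊗ₘ π.1) ≤
      ∫ x, M.rolloutValue r π' (k + 1) x ∂(M.stateAt π t) + b t) (k : ℕ) :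
    ∀ t, t + k = H → ∫ x, M.rolloutValue r π k x ∂(M.stateAt π t) ≤
      ∫ x, M.rolloutValue r π' k x ∂(M.stateAt π t) + ∑ l ∈ Finset.Ico t H, b l := by
  induction k with
  | zero =>
    intro t ht
    obtain rfl : t = H := by omega
    simp [rolloutValue_zero]
  | succ k ih =>
    intro t ht
    have hadvantage := hb t k ht
    rw [M.integral_qValue_stateAt hr h1] at hadvantage
    rw [M.integral_rolloutValue_succ hr h1 π, M.integral_qValue_stateAt hr h1,
      Finset.sum_eq_sum_Ico_succ_bot (by omega : t < H)]
    linarith [ih (t + 1) (by omega)]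

end Performance

/-! ### Regression error of a round -/

section Regression

variable {X A : Type*} [MeasurableSpace X] [MeasurableSpace A] {d H n : ℕ} [Fintype A]
variable (M : LowRankMDP X A d H)

/-- The squared error of `g` as an estimate of the action values of `π'` at layer `t`, summed over
the actions and averaged over the states that `P` visits; `r` is the reward of a state-action pair,
whose state carries its layer. -/
def fitError (r : X × A → ℝ) (P : PolicyDist X A) (t : Fin H) (g : X → A → ℝ)
    (π' : Policy X A) : ENNReal :=
  ∫⁻ x, ∑ a, ENNReal.ofReal ((g x a - M.qValue r π' (H - t - 1) (x, a)) ^ 2) ∂(M.mixState P t)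

variable {M}

theorem fitError_congr {r : X × A → ℝ} (hr : Measurable r) (h1 : ∀ p, |r p| ≤ 1)
    (P : PolicyDist X A) (t : Fin H) (g : X → A → ℝ) {π π' : Policy X A}
    (h : ∀ x, (t : ℕ) + 1 ≤ M.layer x → π.1 x = π'.1 x) :
    M.fitError r P t g π = M.fitError r P t g π' := by
  refine lintegral_congr_ae ?_
  filter_upwards [M.mixState_layer P t] with x hx
  refine Finset.sum_congr rfl fun a _ => ?_
  rw [M.qValue_congr hr h1 h (by rw [hx]) (by omega) a]

variable [MeasurableSingletonClass A] [Nonempty A] {r : Fin H → X → A → ℝ}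

theorem fitError_eq_card_mul_integral_sampleLaw (hr : ∀ h a, Measurable fun x => r h x a)
    (h1 : ∀ p, |M.layerReward r p| ≤ 1) (P : PolicyDist X A) (t : Fin H) (π' : Policy X A)
    {g : X → A → ℝ} (hg : ∀ a, Measurable fun x => g x a) {B : ℝ} (hgB : ∀ x a, |g x a| ≤ B) :
    M.fitError (M.layerReward r) P t g π' = Fintype.card A * ENNReal.ofReal
      (∫ z, (g z.1 z.2.1 - M.qValue (M.layerReward r) π' (H - t - 1) (z.1, z.2.1)) ^ 2
        ∂(sampleLaw M r P t π')) := by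
  have hq := M.measurable_qValue (M.measurable_layerReward hr) π' (H - t - 1)
  have hqb := M.abs_qValue_le h1 π' (H - t - 1)
  have hg' : Measurable fun p : X × A => g p.1 p.2 := measurable_from_prod_countable_left hg
  have hpair : Measurable fun z : X × A × ℝ => (z.1, z.2.1) := by fun_prop
  have herr : Measurable fun p : X × A =>
      (g p.1 p.2 - M.qValue (M.layerReward r) π' (H - t - 1) p) ^ 2 := (hg'.sub hq).pow_const 2
  have := M.isProbabilityMeasure_sampleLaw hr P t π'
  have hint : Integrable (fun z : X × A × ℝ =>
      (g z.1 z.2.1 - M.qValue (M.layerReward r) π' (H - t - 1) (z.1, z.2.1)) ^ 2)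
      (sampleLaw M r P t π') := by
    refine integrable_sq_of_abs_le (b := B + ((H - t - 1 : ℕ) + 1))
      ((hg'.sub hq).comp hpair) (.of_forall fun z => ?_)
    exact (abs_sub _ _).trans (add_le_add (hgB _ _) (hqb _))
  rw [fitError, lintegral_sum_eq_card_mul_lintegral_prod_uniformOn _
      (f := fun p => ENNReal.ofReal ((g p.1 p.2 - M.qValue (M.layerReward r) π' _ p) ^ 2))
      herr.ennreal_ofReal,
    ← M.map_stateAction_sampleLaw hr P t π', lintegral_map herr.ennreal_ofReal hpair,
    ofReal_integral_eq_lintegral_ofReal hint (.of_forall fun z => sq_nonneg _)]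

theorem measure_exists_fitError_lt_le (hd : 1 ≤ d) (hn : 1 ≤ n)
    {Φ : Finset (X → A → EuclideanSpace ℝ (Fin d))} (hΦ1 : ∀ φ ∈ Φ, ∀ x a, ‖φ x a‖ ≤ 1)
    (hΦm : ∀ φ ∈ Φ, ∀ a, Measurable fun x => φ x a) {B : ℝ} (hB : H ≤ B)
    (hr : ∀ h a, Measurable fun x => r h x a) (h1 : ∀ p, |M.layerReward r p| ≤ 1)
    (P : PolicyDist X A) (t : Fin H) (π' : Policy X A) {q : X → A → ℝ}
    (hq : ∀ x, M.layer x = t → ∀ a, M.qValue (M.layerReward r) π' (H - t - 1) (x, a) = q x a)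
    (s : ℝ) :
    (Measure.pi fun _ : Fin n => sampleLaw M r P t π')
      {D | ∃ g ∈ linearClass Φ B, squareLoss D g ≤ squareLoss D q ∧
        ENNReal.ofReal (Fintype.card A * ((22 + 200 * s) * B ^ 2 / n)) <
          M.fitError (M.layerReward r) P t g π'} ≤
      ENNReal.ofReal (Φ.card * (2 * ⌈(n : ℝ) * √(d : ℝ)⌉₊ + 1 : ℝ) ^ d * Real.exp (-s)) := by
  have := M.isProbabilityMeasure_sampleLaw hr P t π'
  have hsteps : ((H - t - 1 : ℕ) : ℝ) + 1 ≤ B :=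
    le_trans (by exact_mod_cast (by omega : H - t - 1 + 1 ≤ H)) hB
  have hlayer : ∀ᵐ D ∂(Measure.pi fun _ : Fin n => sampleLaw M r P t π'),
      ∀ j, M.layer (D j).1 = t :=
    ae_all_iff.2 fun j => (Measure.quasiMeasurePreserving_eval
      (fun _ : Fin n => sampleLaw M r P t π') j).ae (M.sampleLaw_layer hr P t π')
  refine (measure_mono_ae ?_).trans (measure_exists_linearClass_risk_lt_le
    (m := sampleLaw M r P t π') hd hn hΦ1 hΦm ((Nat.cast_pos.2 t.pos).trans_le hB)
    (M.measurable_qValue (M.measurable_layerReward hr) π' (H - t - 1))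
    (fun p => (M.abs_qValue_le h1 π' _ p).trans hsteps)
    ((M.sampleLaw_abs_le hr h1 P t (k := H - t - 1) (by omega) π').mono
      fun z hz => hz.trans hsteps)
    (fun f C hf hC => M.integral_mul_residual_sampleLaw hr h1 P t (by omega) π' hf hC) s)
  filter_upwards [hlayer] with D hD
  rintro ⟨g, hg, hloss, herr⟩
  refine ⟨g, hg, hloss.trans_eq (Finset.sum_congr rfl fun j _ => by rw [hq _ (hD j)]), ?_⟩
  rw [fitError_eq_card_mul_integral_sampleLaw hr h1 P t π'
      (measurable_of_mem_linearClass hΦm hg) (abs_le_of_mem_linearClass hΦ1 hg),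
    ← ENNReal.ofReal_natCast, ← ENNReal.ofReal_mul (Nat.cast_nonneg _)] at herr
  exact lt_of_mul_lt_mul_left (ENNReal.ofReal_lt_ofReal_iff'.1 herr).1 (Nat.cast_nonneg _)

theorem measure_fitError_lt_le (hd : 1 ≤ d) (hn : 1 ≤ n)
    {Φ : Finset (X → A → EuclideanSpace ℝ (Fin d))} {θ : Fin H → EuclideanSpace ℝ (Fin d)}
    (hφΦ : ∀ h, M.φ h ∈ Φ) (hΦ1 : ∀ φ ∈ Φ, ∀ x a, ‖φ x a‖ ≤ 1)
    (hΦm : ∀ φ ∈ Φ, ∀ a, Measurable fun x => φ x a) (hθ : ∀ h, ‖θ h‖ ≤ 1)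
    (S : Selection (fun _ : Fin H => linearClass Φ (2 * (H : ℝ) * √(d : ℝ))) n)
    (P : PolicyDist X A) (t : Fin H) (π' : Policy X A) (s : ℝ) :
    (Measure.pi fun _ : Fin n => sampleLaw M (linearReward M θ) P t π')
      {D | ENNReal.ofReal (Fintype.card A * ((22 + 200 * s) * (2 * (H : ℝ) * √(d : ℝ)) ^ 2 / n)) <
        M.fitError (M.layerReward (linearReward M θ)) P t (S.fit t D) π'} ≤
      ENNReal.ofReal (Φ.card * (2 * ⌈(n : ℝ) * √(d : ℝ)⌉₊ + 1 : ℝ) ^ d * Real.exp (-s)) := by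
  have hsqrt : 1 ≤ √(d : ℝ) := Real.one_le_sqrt.2 (by exact_mod_cast hd)
  have hB : (H : ℝ) ≤ 2 * H * √(d : ℝ) := by nlinarith [Nat.cast_nonneg (α := ℝ) H]
  obtain ⟨w, hw, hq⟩ := M.exists_qValue_eq_inner hd hθ π' t (k := H - t - 1) (by omega)
  refine (measure_mono fun D hD => ?_).trans (measure_exists_fitError_lt_le hd hn hΦ1 hΦm hB
    (M.measurable_linearReward θ) (M.abs_layerReward_linearReward_le hθ) P t π' hq s)
  exact ⟨S.fit t D, S.fit_mem t D, S.fit_min t D _ ⟨M.φ t, hφΦ t, w, hw, rfl⟩, hD⟩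

end Regression

section Advantage

variable {X A : Type*} [MeasurableSpace X] [MeasurableSpace A] {d H : ℕ} [Fintype A]
  [MeasurableSingletonClass A] {M : LowRankMDP X A d H} {P : PolicyDist X A} {α ε : ℝ} {t : Fin H}

theorem integral_qValue_le_integral_greedy (hP : IsRandomizedPolicyCover M P α ε t)
    (hα : α ∈ Set.Ioo 0 1) (hε : 0 ≤ ε) {r : X × A → ℝ} (hr : Measurable r)
    (h1 : ∀ p, |r p| ≤ 1) (π π' : Policy X A) {k : ℕ} (hk : (t : ℕ) + (k + 1) = H)
    {g : X → A → ℝ} (hg : ∀ a, Measurable fun x => g x a) {act : X → A} (hact : Measurable act)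
    (hmax : ∀ x a, g x a ≤ g x (act x)) {E : ℝ} (hE : 0 ≤ E)
    (herr : M.fitError r P t g π' ≤ ENNReal.ofReal E) :
    ∫ p, M.qValue r π' k p ∂(M.stateAt π t ⊗ₘ π.1) ≤
      ∫ x, M.qValue r π' k (x, act x) ∂(M.stateAt π t) +
        (2 * √(α⁻¹ * E) +
          2 * (k + 1) * if (t : ℕ) = 0 then 0 else ε * (2 * (d * √(d : ℝ)))) := by
  obtain ⟨s, hs, hrestrict, hout⟩ := hP.exists_restrict_stateAt_le hα hε π
  obtain rfl : k = H - t - 1 := by omega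
  refine (integral_compProd_le_integral_greedy π.1 hs (inv_nonneg.2 hα.1.le) hrestrict
    (M.measurable_qValue hr π' _) (M.abs_qValue_le h1 π' _) hg hact hmax hE herr).trans ?_
  gcongr

end Advantage

end LowRankMDP

/-! ### The learned policies -/

section Family

variable {X A Z : Type*} [MeasurableSpace X] [MeasurableSpace A] [MeasurableSpace Z] {d H : ℕ}
variable (M : LowRankMDP X A d H) {π : Z → Policy X A} {r : X × A → ℝ}

theorem IsMeasurableFamily.rolloutValue (hπ : IsMeasurableFamily π) (hr : Measurable r) (k : ℕ) :
    Measurable fun p : Z × X => M.rolloutValue r (π p.1) k p.2 :=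
  (StronglyMeasurable.integral_kernel (κ := ⟨_, hπ.rollout M k⟩)
    (LowRankMDP.measurable_sum_reward hr k).stronglyMeasurable).measurable

theorem IsMeasurableFamily.qValue (hπ : IsMeasurableFamily π) (hr : Measurable r) (k : ℕ) (a : A) :
    Measurable fun p : Z × X => M.qValue r (π p.1) k (p.2, a) := by
  have hpair : Measurable fun p : Z × X => (p.2, a) := by fun_prop
  have hnext : Measurable fun q : (Z × X) × X => M.rolloutValue r (π q.1.1) k q.2 :=
    (hπ.rolloutValue M hr k).comp
      (by fun_prop : Measurable fun q : (Z × X) × X => (q.1.1, q.2))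
  exact (hr.comp hpair).add (StronglyMeasurable.integral_kernel_prod_right'
    (κ := M.T.comap _ hpair) hnext.stronglyMeasurable).measurable

end Family

section LearnedPolicy

variable {X A : Type*} [MeasurableSpace X] [MeasurableSpace A] [Nonempty A] {d H n : ℕ}
  {G : Fin H → Set (X → A → ℝ)} (M : LowRankMDP X A d H) (S : Selection G n)

theorem measurable_learnedAct (k : ℕ) :
    Measurable fun p : (Fin k → Dataset X A n) × X => learnedAct S p.1 (M.layer p.2) p.2 := by
  suffices Measurable fun q : Fin H × ((Fin k → Dataset X A n) × X) =>
      learnedAct S q.2.1 q.1 q.2.2 from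
    this.comp ((M.layer_measurable.comp measurable_snd).prodMk measurable_id)
  refine measurable_from_prod_countable_right fun j => ?_
  simp only [learnedAct]
  split_ifs with hj
  · exact (S.act_measurable j).comp (f := fun y : (Fin k → Dataset X A n) × X =>
      (y.1 ⟨(j : ℕ) - (H - k), by omega⟩, y.2)) (by fun_prop)
  · exact measurable_const

theorem learnedPolicy_apply {k : ℕ} (D : Fin k → Dataset X A n) (x : X) :
    (learnedPolicy M S D).1 x = Measure.dirac (learnedAct S D (M.layer x) x) := by
  simp only [learnedPolicy, Kernel.deterministic_apply]

theorem isMeasurableFamily_learnedPolicy (k : ℕ) :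
    IsMeasurableFamily fun D : Fin k → Dataset X A n => learnedPolicy M S D := by
  simp_rw [IsMeasurableFamily, learnedPolicy_apply]
  exact Measure.measurable_dirac.comp (measurable_learnedAct M S k)

theorem learnedPolicy_cons_apply {k : ℕ} (hk : k + 1 ≤ H) (D : Fin k → Dataset X A n)
    (D' : Dataset X A n) {x : X} (hx : H - k ≤ (M.layer x : ℕ)) :
    (learnedPolicy M S (Fin.cons (α := fun _ => Dataset X A n) D' D)).1 x =
      (learnedPolicy M S D).1 x := by
  have hsucc : (⟨(M.layer x : ℕ) - (H - (k + 1)), by omega⟩ : Fin (k + 1)) =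
      Fin.succ ⟨(M.layer x : ℕ) - (H - k), by omega⟩ :=
    Fin.ext (by simp only [Fin.val_succ]; omega)
  rw [learnedPolicy_apply, learnedPolicy_apply, learnedAct, learnedAct, dif_pos hx,
    dif_pos (by omega), hsucc, Fin.cons_succ]

end LearnedPolicy

/-! ### The law of the datasets -/

section PSDP

variable {X A : Type*} [MeasurableSpace X] [MeasurableSpace A] [Nonempty A] [Fintype A]
  {d H n : ℕ} {G : Fin H → Set (X → A → ℝ)} (M : LowRankMDP X A d H) (S : Selection G n)

theorem measurable_fitError {r : X × A → ℝ} (hr : Measurable r) (P : PolicyDist X A) (t : Fin H)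
    (k : ℕ) : Measurable fun p : Dataset X A n × (Fin k → Dataset X A n) =>
      M.fitError r P t (S.fit t p.1) (learnedPolicy M S p.2) := by
  refine Measurable.lintegral_prod_right' (f := fun q :
    (Dataset X A n × (Fin k → Dataset X A n)) × X => ∑ a, ENNReal.ofReal ((S.fit t q.1.1 q.2 a -
      M.qValue r (learnedPolicy M S q.1.2) (H - t - 1) (q.2, a)) ^ 2)) ?_
  refine Finset.measurable_sum _ fun a _ => Measurable.ennreal_ofReal (Measurable.pow_const ?_ 2)
  have hfit := (S.fit_measurable t a).comp (by fun_prop : Measurable fun q :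
    (Dataset X A n × (Fin k → Dataset X A n)) × X => (q.1.1, q.2))
  have hq := ((isMeasurableFamily_learnedPolicy M S k).qValue M hr (H - t - 1) a).comp
    (by fun_prop : Measurable fun q :
      (Dataset X A n × (Fin k → Dataset X A n)) × X => (q.1.2, q.2))
  exact hfit.sub hq

/-- The failure event after `k` rounds: at one of the last `k` layers `t`, the fitted function has a
squared error above `β`. The policy learned from all the `k` datasets stands for the one learned
before layer `t` was reached, since both agree after layer `t`. -/
def badData (r : X × A → ℝ) (P : Fin H → PolicyDist X A) (β : ENNReal) (k : ℕ) :
    Set (Fin k → Dataset X A n) :=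
  {D | ∃ t : Fin H, ∃ h : H - k ≤ (t : ℕ),
    β < M.fitError r (P t) t (S.fit t (D ⟨t - (H - k), by omega⟩)) (learnedPolicy M S D)}

theorem measurableSet_badData {r : X × A → ℝ} (hr : Measurable r) (P : Fin H → PolicyDist X A)
    (β : ENNReal) (k : ℕ) : MeasurableSet (badData M S r P β k) := by
  have eq_iUnion : badData M S r P β k = ⋃ (t : Fin H) (h : H - k ≤ (t : ℕ)),
      {D | β < M.fitError r (P t) t (S.fit t (D ⟨t - (H - k), by omega⟩))
        (learnedPolicy M S D)} := by
    ext D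
    simp only [badData, Set.mem_iUnion, Set.mem_ofPred_eq]
  rw [eq_iUnion]
  refine MeasurableSet.iUnion fun t => MeasurableSet.iUnion fun h => ?_
  have hdata : Measurable fun D : Fin k → Dataset X A n =>
      (D ⟨(t : ℕ) - (H - k), by omega⟩, D) := by fun_prop
  have herr := (measurable_fitError M S hr (P t) t k).comp hdata
  simp only [Function.comp_def] at herr
  exact measurableSet_lt measurable_const herr

theorem badData_zero (r : X × A → ℝ) (P : Fin H → PolicyDist X A) (β : ENNReal) :
    badData M S r P β 0 = ∅ := by
  refine Set.eq_empty_of_forall_notMem fun D ⟨t, h, _⟩ => ?_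
  omega

theorem lt_fitError_of_cons_mem_badData {r : X × A → ℝ} (hr : Measurable r) (h1 : ∀ p, |r p| ≤ 1)
    (P : Fin H → PolicyDist X A) {β : ENNReal} {t : Fin H} {k : ℕ} (ht : (t : ℕ) + (k + 1) = H)
    {D : Fin k → Dataset X A n} (hD : D ∉ badData M S r P β k) {D' : Dataset X A n}
    (hcons : Fin.cons (α := fun _ => Dataset X A n) D' D ∈ badData M S r P β (k + 1)) :
    β < M.fitError r (P t) t (S.fit t D') (learnedPolicy M S D) := by
  obtain ⟨t', h, hlt⟩ := hcons
  rw [LowRankMDP.fitError_congr hr h1 (P t') t' _ fun x hx =>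
    learnedPolicy_cons_apply M S (by omega) D D' (by omega)] at hlt
  rcases Nat.lt_or_ge (t' : ℕ) (H - k) with hnew | hold
  · obtain rfl : t' = t := Fin.ext (by omega)
    have hzero : (⟨(t' : ℕ) - (H - (k + 1)), by omega⟩ : Fin (k + 1)) = 0 :=
      Fin.ext (by simp only [Fin.val_zero]; omega)
    rwa [hzero, Fin.cons_zero] at hlt
  · have hsucc : (⟨(t' : ℕ) - (H - (k + 1)), by omega⟩ : Fin (k + 1)) =
        Fin.succ ⟨(t' : ℕ) - (H - k), by omega⟩ := Fin.ext (by simp only [Fin.val_succ]; omega)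
    rw [hsucc, Fin.cons_succ] at hlt
    exact absurd ⟨t', hold, hlt⟩ hD

variable [MeasurableSingletonClass A] {r : Fin H → X → A → ℝ}

theorem psdpLaw_succ_apply (hr : ∀ h a, Measurable fun x => r h x a) (P : Fin H → PolicyDist X A)
    {t : Fin H} {k : ℕ} (ht : (t : ℕ) + (k + 1) = H) {s : Set (Fin (k + 1) → Dataset X A n)}
    (hs : MeasurableSet s) :
    psdpLaw M r S P (k + 1) (by omega) s =
      ∫⁻ D, (Measure.pi fun _ : Fin n => sampleLaw M r (P t) t (learnedPolicy M S D))
        {D' | Fin.cons (α := fun _ => Dataset X A n) D' D ∈ s}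
        ∂(psdpLaw M r S P k (by omega)) := by
  have := fun D : Fin k → Dataset X A n =>
    M.isProbabilityMeasure_sampleLaw hr (P t) t (learnedPolicy M S D)
  let κ : Kernel (Fin k → Dataset X A n) (Dataset X A n) :=
    ⟨_, measurable_pi_const n (M.measurable_sampleLaw hr (P t) t
      (isMeasurableFamily_learnedPolicy M S k))⟩
  have : IsMarkovKernel κ := ⟨fun D => inferInstanceAs (IsProbabilityMeasure (Measure.pi _))⟩
  have hk : k + 1 ≤ H := by omega
  obtain rfl : t = ⟨H - (k + 1), Nat.sub_lt_self k.succ_pos hk⟩ :=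
    Fin.ext (by simp only; omega)
  exact bind_map_apply _ κ (measurable_finCons k) hs

theorem isProbabilityMeasure_psdpLaw (hr : ∀ h a, Measurable fun x => r h x a)
    (P : Fin H → PolicyDist X A) {k : ℕ} (hk : k ≤ H) :
    IsProbabilityMeasure (psdpLaw M r S P k hk) := by
  induction k with
  | zero => rw [psdpLaw]; infer_instance
  | succ k ih =>
    have := ih (by omega)
    have := fun t (D : Fin k → Dataset X A n) =>
      M.isProbabilityMeasure_sampleLaw hr (P t) t (learnedPolicy M S D)
    have ht : H - (k + 1) + (k + 1) = H := Nat.sub_add_cancel hk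
    exact ⟨by simp [psdpLaw_succ_apply M S hr P (t := ⟨H - (k + 1), by omega⟩) ht .univ]⟩

theorem psdpLaw_badData_succ_le (hr : ∀ h a, Measurable fun x => r h x a)
    (h1 : ∀ p, |M.layerReward r p| ≤ 1) (P : Fin H → PolicyDist X A) {β η : ENNReal} {t : Fin H}
    {k : ℕ} (ht : (t : ℕ) + (k + 1) = H)
    (hη : ∀ π' : Policy X A, (Measure.pi fun _ : Fin n => sampleLaw M r (P t) t π')
      {D | β < M.fitError (M.layerReward r) (P t) t (S.fit t D) π'} ≤ η) :
    psdpLaw M r S P (k + 1) (by omega) (badData M S (M.layerReward r) P β (k + 1)) ≤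
      psdpLaw M r S P k (by omega) (badData M S (M.layerReward r) P β k) + η := by
  have hr' := M.measurable_layerReward hr
  have hprob := isProbabilityMeasure_psdpLaw M S hr P (by omega : k ≤ H)
  have := fun D : Fin k → Dataset X A n =>
    M.isProbabilityMeasure_sampleLaw hr (P t) t (learnedPolicy M S D)
  rw [psdpLaw_succ_apply M S hr P ht (measurableSet_badData M S hr' P β (k + 1))]
  have hround : ∀ D : Fin k → Dataset X A n,
      (Measure.pi fun _ : Fin n => sampleLaw M r (P t) t (learnedPolicy M S D))
        {D' | Fin.cons (α := fun _ => Dataset X A n) D' D ∈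
          badData M S (M.layerReward r) P β (k + 1)} ≤
      (badData M S (M.layerReward r) P β k).indicator 1 D + η := by
    intro D
    by_cases hD : D ∈ badData M S (M.layerReward r) P β k
    · rw [Set.indicator_of_mem hD]
      exact prob_le_one.trans le_self_add
    · rw [Set.indicator_of_notMem hD, zero_add]
      exact (measure_mono (Set.ofPred_subset_ofPred.2 fun D' hD' =>
        lt_fitError_of_cons_mem_badData M S hr' h1 P ht hD hD')).trans (hη _)
  refine (lintegral_mono hround).trans_eq ?_
  rw [lintegral_add_right _ measurable_const,
    lintegral_indicator_one (measurableSet_badData M S hr' P β k), lintegral_const, measure_univ,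
    mul_one]

theorem psdpLaw_badData_le (hr : ∀ h a, Measurable fun x => r h x a)
    (h1 : ∀ p, |M.layerReward r p| ≤ 1) (P : Fin H → PolicyDist X A) {β η : ENNReal}
    (hη : ∀ (t : Fin H) (π' : Policy X A),
      (Measure.pi fun _ : Fin n => sampleLaw M r (P t) t π')
        {D | β < M.fitError (M.layerReward r) (P t) t (S.fit t D) π'} ≤ η) {k : ℕ} (hk : k ≤ H) :
    psdpLaw M r S P k hk (badData M S (M.layerReward r) P β k) ≤ k * η := by
  induction k with
  | zero => simp [badData_zero]
  | succ k ih =>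
    have ht : H - (k + 1) + (k + 1) = H := Nat.sub_add_cancel hk
    refine (psdpLaw_badData_succ_le M S hr h1 P (t := ⟨H - (k + 1), by omega⟩) ht
      (hη _)).trans ?_
    rw [Nat.cast_add_one, add_mul, one_mul]
    gcongr
    exact ih (by omega)

end PSDP

/-! ### Constants -/

section Constants

theorem sum_range_two_mul_sub (m : ℕ) :
    ∑ t ∈ Finset.range m, 2 * ((m : ℝ) - t) = m * (m + 1) := by
  induction m with
  | zero => simp
  | succ m ih =>
    have hshift : ∀ t : ℕ, ((m + 1 : ℕ) : ℝ) - ((t + 1 : ℕ) : ℝ) = m - t := fun t => by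
      push_cast; ring
    simp_rw [Finset.sum_range_succ', hshift, ih]
    push_cast
    ring

theorem sum_range_two_mul_sub_mul_ite_le (m : ℕ) {b : ℝ} (hb : 0 ≤ b) :
    ∑ t ∈ Finset.range m, 2 * ((m : ℝ) - t) * (if t = 0 then 0 else b) ≤ m ^ 2 * b := by
  cases m with
  | zero => simp
  | succ m =>
    have hshift : ∀ t : ℕ, ((m + 1 : ℕ) : ℝ) - ((t + 1 : ℕ) : ℝ) = m - t := fun t => by
      push_cast; ring
    simp only [Finset.sum_range_succ', hshift, Nat.add_eq_zero_iff, one_ne_zero, and_false,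
      if_false, if_true, mul_zero, add_zero]
    rw [← Finset.sum_mul, sum_range_two_mul_sub]
    gcongr
    push_cast
    nlinarith [(Nat.cast_nonneg m : (0 : ℝ) ≤ m)]

theorem rpow_three_halves {x : ℝ} (hx : 0 ≤ x) : x ^ (3 / 2 : ℝ) = x * √x := by
  rw [Real.sqrt_eq_rpow, ← Real.rpow_one_add' hx (by norm_num)]
  norm_num

theorem half_le_log {x : ℝ} (hx : 2 ≤ x) : 1 / 2 ≤ Real.log x := by
  linarith [Real.log_le_log two_pos hx, Real.log_two_gt_d9]

theorem log_two_mul_ceil_add_one_le {x y : ℝ} (hy : 1 ≤ y) (hyx : 2 * y ≤ x) :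
    Real.log (2 * ⌈y⌉₊ + 1 : ℝ) ≤ 3 * Real.log x := by
  have hcube : (2 * ⌈y⌉₊ + 1 : ℝ) ≤ x ^ 3 := by
    have hceil := (Nat.ceil_lt_add_one (zero_le_one.trans hy)).le
    have hsq : 4 ≤ x ^ 2 := by nlinarith
    nlinarith
  have hlog := Real.log_le_log (by positivity) hcube
  rwa [Real.log_pow, Nat.cast_ofNat] at hlog

/-- The logarithmic factor of the guarantee, for a class of `N` features. -/
def logFactor (d H n N : ℕ) (δ : ℝ) : ℝ :=
  (d : ℝ) * Real.log (2 * (n : ℝ) * √(d : ℝ) * (H : ℝ)) + Real.log ((n : ℝ) * N / δ)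

variable {d H n N : ℕ} {δ : ℝ}

theorem two_mul_le_log_argument (hd : 1 ≤ d) (hH : 1 ≤ H) (hn : 1 ≤ n) :
    1 ≤ (n : ℝ) * √(d : ℝ) ∧ 2 * ((n : ℝ) * √(d : ℝ)) ≤ 2 * n * √(d : ℝ) * H := by
  have hH1 : (1 : ℝ) ≤ H := by exact_mod_cast hH
  refine ⟨one_le_mul_of_one_le_of_one_le (by exact_mod_cast hn)
    (Real.one_le_sqrt.2 (by exact_mod_cast hd)), ?_⟩
  rw [← mul_assoc]
  exact le_mul_of_one_le_right (by positivity) hH1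

theorem log_mul_div_nonneg (hn : 1 ≤ n) (hN : 1 ≤ N) (hδ : δ ∈ Set.Ioo 0 1) :
    0 ≤ Real.log ((n : ℝ) * N / δ) := by
  refine Real.log_nonneg ((one_le_div hδ.1).2 (hδ.2.le.trans ?_))
  exact_mod_cast Nat.mul_pos hn hN

theorem half_le_logFactor (hd : 1 ≤ d) (hH : 1 ≤ H) (hn : 1 ≤ n) (hN : 1 ≤ N)
    (hδ : δ ∈ Set.Ioo 0 1) : 1 / 2 ≤ logFactor d H n N δ := by
  obtain ⟨hy, hyx⟩ := two_mul_le_log_argument hd hH hn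
  have hlog := half_le_log (by linarith : 2 ≤ 2 * (n : ℝ) * √(d : ℝ) * H)
  have hd1 : (1 : ℝ) ≤ d := by exact_mod_cast hd
  rw [logFactor]
  nlinarith [log_mul_div_nonneg hn hN hδ]

theorem log_net_mul_div_le (hd : 1 ≤ d) (hH : 1 ≤ H) (hn : 1 ≤ n) (hN : 1 ≤ N)
    (hδ : δ ∈ Set.Ioo 0 1) :
    Real.log (N * (2 * ⌈(n : ℝ) * √(d : ℝ)⌉₊ + 1 : ℝ) ^ d * H / δ) ≤ 4 * logFactor d H n N δ := by
  have hδ0 := hδ.1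
  have hd1 : (1 : ℝ) ≤ d := by exact_mod_cast hd
  have hH1 : (1 : ℝ) ≤ H := by exact_mod_cast hH
  have hn1 : (1 : ℝ) ≤ n := by exact_mod_cast hn
  have : (1 : ℝ) ≤ N := by exact_mod_cast hN
  obtain ⟨hy, hyx⟩ := two_mul_le_log_argument hd hH hn
  have hHx : (H : ℝ) ≤ 2 * n * √(d : ℝ) * H := le_mul_of_one_le_left (by positivity) (by linarith)
  have hL := half_le_log (by linarith : 2 ≤ 2 * (n : ℝ) * √(d : ℝ) * H)
  have hnet := log_two_mul_ceil_add_one_le hy hyx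
  have hlogH := Real.log_le_log (by linarith) hHx
  have hlogn : Real.log (N / δ) ≤ Real.log ((n : ℝ) * N / δ) := by
    gcongr
    exact le_mul_of_one_le_left (by positivity) hn1
  have hsplit : Real.log (N * (2 * ⌈(n : ℝ) * √(d : ℝ)⌉₊ + 1 : ℝ) ^ d * H / δ) =
      d * Real.log (2 * ⌈(n : ℝ) * √(d : ℝ)⌉₊ + 1 : ℝ) + Real.log H + Real.log (N / δ) := by
    rw [← Real.log_pow, ← Real.log_mul (by positivity) (by positivity),
      ← Real.log_mul (by positivity) (by positivity)]
    congr 1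
    ring
  rw [hsplit, logFactor]
  nlinarith [log_mul_div_nonneg hn hN hδ]

theorem statistical_term_le {d A H n α s Γ : ℝ} (hd : 0 ≤ d) (hA : 0 ≤ A) (hH : 0 ≤ H) (hn : 0 < n)
    (hα : 0 < α) (hΓ : 1 / 2 ≤ Γ) (hs : s ≤ 4 * Γ) :
    H * (2 * √(α⁻¹ * (A * ((22 + 200 * s) * (2 * H * √d) ^ 2 / n)))) ≤
      120 * H ^ 2 * √(d * A * Γ / (α * n)) := by
  have hsq : α⁻¹ * (A * ((22 + 200 * s) * (2 * H * √d) ^ 2 / n)) ≤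
      (60 * H) ^ 2 * (d * A * Γ / (α * n)) := by
    calc α⁻¹ * (A * ((22 + 200 * s) * (2 * H * √d) ^ 2 / n))
        = (4 * (22 + 200 * s)) * (A * H ^ 2 * d / (n * α)) := by
          rw [mul_pow, mul_pow, Real.sq_sqrt hd]
          field_simp
          ring
      _ ≤ (3600 * Γ) * (A * H ^ 2 * d / (n * α)) :=
          mul_le_mul_of_nonneg_right (by linarith) (by positivity)
      _ = (60 * H) ^ 2 * (d * A * Γ / (α * n)) := by
          field_simp
          ring
  calc H * (2 * √(α⁻¹ * (A * ((22 + 200 * s) * (2 * H * √d) ^ 2 / n))))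
      ≤ H * (2 * √((60 * H) ^ 2 * (d * A * Γ / (α * n)))) := by gcongr
    _ = 120 * H ^ 2 * √(d * A * Γ / (α * n)) := by
        rw [Real.sqrt_mul (by positivity), Real.sqrt_sq (by positivity)]
        ring

end Constants

/-! ### The guarantee -/

section Guarantee

variable {X A : Type*} [MeasurableSpace X] [MeasurableSpace A] {d H n : ℕ}

theorem LowRankMDP.horizon_pos (M : LowRankMDP X A d H) : 0 < H := by
  obtain ⟨x⟩ := nonempty_of_isProbabilityMeasure M.ρ
  exact (M.layer x).pos

theorem LowRankMDP.value_linearReward_of_dim_zero (M : LowRankMDP X A 0 H)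
    (θ : Fin H → EuclideanSpace ℝ (Fin 0)) (π : Policy X A) :
    M.value (linearReward M θ) π = 0 := by
  simp [LowRankMDP.value, linearReward, Subsingleton.elim (θ _) 0]

variable [Nonempty A] {G : Fin H → Set (X → A → ℝ)}

theorem learnedAct_eq_act (S : Selection G n) (D : Fin H → Dataset X A n) (t : Fin H) (x : X) :
    learnedAct S D t x = S.act t (D t) x := by
  simp only [learnedAct, tsub_self, zero_le, dite_true, tsub_zero, Fin.eta]

section Greedy

variable (M : LowRankMDP X A d H) (S : Selection G n)

theorem rolloutValue_learnedPolicy_succ [MeasurableSingletonClass A] {r : X × A → ℝ}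
    (hr : Measurable r) (h1 : ∀ p, |r p| ≤ 1) (D : Fin H → Dataset X A n) (k : ℕ) {t : Fin H}
    {x : X} (hx : M.layer x = t) :
    M.rolloutValue r (learnedPolicy M S D) (k + 1) x =
      M.qValue r (learnedPolicy M S D) k (x, S.act t (D t) x) := by
  rw [M.rolloutValue_succ hr h1, learnedPolicy_apply, hx, integral_dirac, learnedAct_eq_act]

variable [Fintype A]

theorem fitError_le_of_notMem_badData {r : X × A → ℝ} {P : Fin H → PolicyDist X A} {β : ENNReal}
    {D : Fin H → Dataset X A n} (hD : D ∉ badData M S r P β H) (t : Fin H) :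
    M.fitError r (P t) t (S.fit t (D t)) (learnedPolicy M S D) ≤ β := by
  by_contra! h
  exact hD ⟨t, by omega, by simpa only [tsub_self, tsub_zero, Fin.eta] using h⟩

variable [MeasurableSingletonClass A] {P : Fin H → PolicyDist X A} {α ε : ℝ}

theorem integral_qValue_le_integral_rolloutValue_learnedPolicy (hα : α ∈ Set.Ioo 0 1)
    (hε : 0 ≤ ε) (hP : ∀ h, IsRandomizedPolicyCover M (P h) α ε h) {r : X × A → ℝ}
    (hr : Measurable r) (h1 : ∀ p, |r p| ≤ 1) {E : ℝ} (hE : 0 ≤ E) {D : Fin H → Dataset X A n}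
    (hD : D ∉ badData M S r P (ENNReal.ofReal E) H) (π : Policy X A) {t k : ℕ}
    (hk : t + (k + 1) = H) :
    ∫ p, M.qValue r (learnedPolicy M S D) k p ∂(M.stateAt π t ⊗ₘ π.1) ≤
      ∫ x, M.rolloutValue r (learnedPolicy M S D) (k + 1) x ∂(M.stateAt π t) +
        (2 * √(α⁻¹ * E) +
          2 * ((H : ℝ) - t) * if t = 0 then 0 else ε * (2 * (d * √(d : ℝ)))) := by
  lift t to Fin H using by omega
  have hgreedy : ∫ x, M.rolloutValue r (learnedPolicy M S D) (k + 1) x ∂(M.stateAt π t) =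
      ∫ x, M.qValue r (learnedPolicy M S D) k (x, S.act t (D t) x) ∂(M.stateAt π t) := by
    refine integral_congr_ae ?_
    filter_upwards [M.stateAt_layer π t] with x hx
    exact rolloutValue_learnedPolicy_succ M S hr h1 D k hx
  have hsteps : (H : ℝ) - (t : ℕ) = k + 1 := sub_eq_iff_eq_add'.2 (by exact_mod_cast hk.symm)
  rw [hgreedy, hsteps]
  exact LowRankMDP.integral_qValue_le_integral_greedy (hP t) hα hε hr h1 π _ hk
    (fun a => (S.fit_measurable t a).comp measurable_prodMk_left)
    ((S.act_measurable t).comp measurable_prodMk_left) (S.act_max t (D t)) hE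
    (fitError_le_of_notMem_badData M S hD t)

theorem value_le_of_notMem_badData (hα : α ∈ Set.Ioo 0 1) (hε : 0 ≤ ε)
    (hP : ∀ h, IsRandomizedPolicyCover M (P h) α ε h) {r : Fin H → X → A → ℝ}
    (hr : ∀ h a, Measurable fun x => r h x a) (h1 : ∀ p, |M.layerReward r p| ≤ 1) {E : ℝ}
    (hE : 0 ≤ E) {D : Fin H → Dataset X A n}
    (hD : D ∉ badData M S (M.layerReward r) P (ENNReal.ofReal E) H) (π : Policy X A) :
    M.value r π ≤ M.value r (learnedPolicy M S D) +
      (H * (2 * √(α⁻¹ * E)) + H ^ 2 * (ε * (2 * (d * √(d : ℝ))))) := by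
  have hr' := M.measurable_layerReward hr
  have hdifference := M.integral_rolloutValue_le_add_sum hr' h1 π (learnedPolicy M S D)
    (fun t k hk => integral_qValue_le_integral_rolloutValue_learnedPolicy M S hα hε hP hr' h1 hE
      hD π hk) H 0 (zero_add H)
  rw [Nat.Ico_zero_eq_range, Finset.sum_add_distrib, Finset.sum_const, Finset.card_range,
    nsmul_eq_mul] at hdifference
  rw [M.value_eq_integral_rolloutValue hr h1, M.value_eq_integral_rolloutValue hr h1]
  exact hdifference.trans (add_le_add le_rfl (add_le_add le_rfl
    (sum_range_two_mul_sub_mul_ite_le H (by positivity))))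

theorem one_sub_le_psdpLaw_forall_value_le (hα : α ∈ Set.Ioo 0 1) (hε : 0 ≤ ε)
    (hP : ∀ h, IsRandomizedPolicyCover M (P h) α ε h) {r : Fin H → X → A → ℝ}
    (hr : ∀ h a, Measurable fun x => r h x a) (h1 : ∀ p, |M.layerReward r p| ≤ 1) {E : ℝ}
    (hE : 0 ≤ E) {η : ENNReal}
    (hη : ∀ (t : Fin H) (π' : Policy X A), (Measure.pi fun _ : Fin n => sampleLaw M r (P t) t π')
      {D | ENNReal.ofReal E < M.fitError (M.layerReward r) (P t) t (S.fit t D) π'} ≤ η) :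
    1 - H * η ≤ psdpLaw M r S P H le_rfl {D | ∀ π : Policy X A,
      M.value r π ≤ M.value r (learnedPolicy M S D) +
        (H * (2 * √(α⁻¹ * E)) + H ^ 2 * (ε * (2 * (d * √(d : ℝ)))))} := by
  have := isProbabilityMeasure_psdpLaw M S hr P (le_refl H)
  have hmeas := measurableSet_badData M S (M.measurable_layerReward hr) P (ENNReal.ofReal E) H
  calc 1 - H * η
      ≤ 1 - psdpLaw M r S P H le_rfl (badData M S (M.layerReward r) P (ENNReal.ofReal E) H) :=
        tsub_le_tsub_left (psdpLaw_badData_le M S hr h1 P hη le_rfl) 1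
    _ = psdpLaw M r S P H le_rfl (badData M S (M.layerReward r) P (ENNReal.ofReal E) H)ᶜ :=
        (prob_compl_eq_one_sub hmeas).symm
    _ ≤ _ := measure_mono fun D hD π =>
        value_le_of_notMem_badData M S hα hε hP hr h1 hE hD π

end Greedy

theorem one_sub_le_psdpLaw_linearClass [Fintype A] [MeasurableSingletonClass A] (hd : 1 ≤ d)
    (hn : 1 ≤ n) (M : LowRankMDP X A d H) {Φ : Finset (X → A → EuclideanSpace ℝ (Fin d))}
    {θ : Fin H → EuclideanSpace ℝ (Fin d)} {P : Fin H → PolicyDist X A} {α ε δ : ℝ}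
    (hα : α ∈ Set.Ioo 0 1) (hε : 0 ≤ ε) (hδ : δ ∈ Set.Ioo 0 1) (hφΦ : ∀ h, M.φ h ∈ Φ)
    (hΦ1 : ∀ φ ∈ Φ, ∀ x a, ‖φ x a‖ ≤ 1) (hΦm : ∀ φ ∈ Φ, ∀ a, Measurable fun x => φ x a)
    (hθ : ∀ h, ‖θ h‖ ≤ 1) (hP : ∀ h, IsRandomizedPolicyCover M (P h) α ε h)
    (S : Selection (fun _ : Fin H => linearClass Φ (2 * (H : ℝ) * √(d : ℝ))) n) :
    ENNReal.ofReal (1 - δ) ≤ psdpLaw M (linearReward M θ) S P H le_rfl {D | ∀ π : Policy X A,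
      M.value (linearReward M θ) π ≤ M.value (linearReward M θ) (learnedPolicy M S D) +
        (120 * (H : ℝ) ^ 2 *
            √(d * Fintype.card A * logFactor d H n Φ.card δ / (α * n)) +
          H ^ 2 * (ε * (2 * (d * √(d : ℝ)))))} := by
  have hH := M.horizon_pos
  have hN : 1 ≤ Φ.card := Finset.card_pos.2 ⟨_, hφΦ ⟨0, hH⟩⟩
  have hδ0 := hδ.1
  set W : ℝ := Φ.card * (2 * ⌈(n : ℝ) * √(d : ℝ)⌉₊ + 1 : ℝ) ^ d
  have hW1 : 1 ≤ W := one_le_mul_of_one_le_of_one_le (by exact_mod_cast hN)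
    (one_le_pow₀ (le_add_of_nonneg_left (by positivity)))
  set s := Real.log (W * H / δ) with hs
  have hs0 : 0 ≤ s := Real.log_nonneg ((one_le_div hδ0).2 (hδ.2.le.trans
    (one_le_mul_of_one_le_of_one_le hW1 (by exact_mod_cast hH))))
  have hfail : (H : ENNReal) * ENNReal.ofReal (W * Real.exp (-s)) = ENNReal.ofReal δ := by
    rw [← ENNReal.ofReal_natCast, ← ENNReal.ofReal_mul (by positivity), hs, Real.exp_neg,
      Real.exp_log (by positivity)]
    congr 1
    field_simp
  have hguarantee := one_sub_le_psdpLaw_forall_value_le M S hα hε hP (M.measurable_linearReward θ)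
    (M.abs_layerReward_linearReward_le hθ)
    (E := Fintype.card A * ((22 + 200 * s) * (2 * (H : ℝ) * √(d : ℝ)) ^ 2 / n)) (by positivity)
    fun t π' => LowRankMDP.measure_fitError_lt_le hd hn hφΦ hΦ1 hΦm hθ S (P t) t π' s
  rw [hfail, ← ENNReal.ofReal_one, ← ENNReal.ofReal_sub _ hδ0.le] at hguarantee
  refine hguarantee.trans (measure_mono (Set.ofPred_subset_ofPred.2 fun D hD π => ?_))
  have hstat := statistical_term_le d.cast_nonneg (Fintype.card A).cast_nonneg H.cast_nonneg
    (Nat.cast_pos.2 hn) hα.1 (half_le_logFactor hd hH hn hN hδ) (log_net_mul_div_le hd hH hn hN hδ)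
  exact (hD π).trans (add_le_add le_rfl (add_le_add hstat le_rfl))

end Guarantee

end

end LowRank

theorem mainTheorem12 :
    ∃ c : ℝ, 0 < c ∧
      ∀ (X A : Type*) [MeasurableSpace X] [MeasurableSpace A] [MeasurableSingletonClass A]
        [Fintype A] [Nonempty A] (d H n : ℕ) (M : LowRank.LowRankMDP X A d H)
        (Φ : Finset (X → A → EuclideanSpace ℝ (Fin d)))
        (θ : Fin H → EuclideanSpace ℝ (Fin d))
        (P : Fin H → LowRank.PolicyDist X A) (α ε δ : ℝ),
        1 ≤ n → α ∈ Set.Ioo 0 1 → ε ∈ Set.Ioo 0 1 → δ ∈ Set.Ioo 0 1 →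
        (∀ h, M.φ h ∈ Φ) →
        (∀ φ ∈ Φ, ∀ x a, ‖φ x a‖ ≤ 1) →
        (∀ φ ∈ Φ, ∀ a, Measurable fun x => φ x a) →
        (∀ h, ‖θ h‖ ≤ 1) →
        (∀ h, LowRank.IsRandomizedPolicyCover M (P h) α ε h) →
        ∀ S : LowRank.Selection
            (fun _ : Fin H => LowRank.linearClass Φ (2 * (H : ℝ) * √(d : ℝ))) n,
          ENNReal.ofReal (1 - δ) ≤
            LowRank.psdpLaw M (LowRank.linearReward M θ) S P H le_rfl
              {D | ∀ π : LowRank.Policy X A,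
                M.value (LowRank.linearReward M θ) π ≤
                  M.value (LowRank.linearReward M θ) (LowRank.learnedPolicy M S D) +
                    c * (H : ℝ) ^ 2 *
                      √((d : ℝ) * (Fintype.card A : ℝ) *
                          ((d : ℝ) * Real.log (2 * (n : ℝ) * √(d : ℝ) * (H : ℝ)) +
                            Real.log ((n : ℝ) * (Φ.card : ℝ) / δ)) / (α * (n : ℝ))) +
                    2 * (H : ℝ) ^ 2 * ε * (d : ℝ) ^ (3 / 2 : ℝ)} := by
  refine ⟨120, by norm_num, ?_⟩
  intro X A _ _ _ _ _ d H n M Φ θ P α ε δ hn hα hε hδ hφΦ hΦ1 hΦm hθ hP S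
  rcases Nat.eq_zero_or_pos d with rfl | hd
  · have := LowRank.isProbabilityMeasure_psdpLaw M S (M.measurable_linearReward θ) P (le_refl H)
    have hε0 := hε.1
    refine ((ENNReal.ofReal_le_one.2 (by linarith [hδ.1])).trans_eq measure_univ.symm).trans
      (measure_mono (s := Set.univ) fun D _ π => ?_)
    rw [M.value_linearReward_of_dim_zero, M.value_linearReward_of_dim_zero]
    positivity
  · have hcover : (H : ℝ) ^ 2 * (ε * (2 * (d * √(d : ℝ)))) =
        2 * (H : ℝ) ^ 2 * ε * (d : ℝ) ^ (3 / 2 : ℝ) := by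
      rw [LowRank.rpow_three_halves d.cast_nonneg]
      ring
    have hguarantee := LowRank.one_sub_le_psdpLaw_linearClass hd hn M hα hε.1.le hδ hφΦ hΦ1 hΦm
      hθ hP S
    simpa only [hcover, LowRank.logFactor, ← add_assoc] using hguarantee
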